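/- **Theorem (Time localization of precoded signals).** Let $W'>0$, $T'=\frac1{2W'}$, and let $g\in L^2(\mathbb R;\mathbb C)$ have $L^2$-Fourier transform $G$ (represented by a function $G:\mathbb R\to\mathbb C$; convention $G(\omega)=\int g(t)e^{-i\omega t}\,dt$) such that $|G|$ is piecewise continuously differentiable (that is, $C^1$ off a finite set of points, at which $|G|$ and its derivative have finite one-sided limits), $G(\omega)\ne0$ for $|\omega|\le 2\pi W'$ and $G(\omega)=0$ for $|\omega|>2\pi W'$. Assume that $|G|$ is even almost everywhere, as it is for every real-valued pulse $g$. Put $h_k(t)=g(t-kT')$. For $n\ge 0$ let $H_{2n+1}$ be the matrix with entries $[H_{2n+1}]_{k,\ell}=\langle h_k,h_\ell\rangle=\int h_k\overline{h_\ell}\,dt$, $k,\ell=-n,\dots,n$, and for a data vector $X\in\mathbb R^{2n+1}$ let $A=H_{2n+1}^{-1/2}X$ and $X(t)=\sum_{k=-n}^nA_kh_k(t)$. Write $\|f\|^2=\int_{\mathbb R}|f(t)|^2dt$, $K_D(f,\Omega)=\int_\Omega|f(t)|^2dt\,/\,\|f\|^2$ for the fraction of the energy of $f$ in $\Omega$,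 and $\Omega_n=[-nT',nT']$. Let $\xi^{(n)}_\ell(t)$ denote the effective pulse of the $\ell$-th symbol, i.e. the signal $X(t)$ for the $\ell$-th unit data vector (and $0$ if $|\ell|>n$). Then: 1. $H_{2n+1}$ is positive definite for every $n$ (so $H_{2n+1}^{-1/2}$ exists). 2. For all $n$ and $X\in\mathbb R^{2n+1}$, $X(t)=\sum_{\ell=-n}^{n}X_\ell\,\xi^{(n)}_\ell(t)$ for all $t$, and $\|X(t)\|^2=\sum_\ell X_\ell^2$. 3. The effective pulses tend to a train of pulses at the Nyquist rate: there is $s\in L^2(\mathbb R)$ with Fourier transform $\sqrt{T'}\,G(\omega)/|G(\omega)|$ for $|\omega|\le2\pi W'$ and $0$ for $|\omega|>2\pi W'$ (so its amplitude spectrum is that of a sinc pulse), such that, as $n\to\infty$, $\|\xi^{(n)}_\ell-s(\cdot-\ell T')\|\to0$ for every $\ell\in\mathbb Z$, and $\frac1{2n+1}\sum_{\ell=-n}^n\|\xi^{(n)}_\ell-s(\cdot-\ell T')\|^2\to0$. If $G>0$ on $|\omega|\le2\pi W'$, then $s$ is the sinc pulse $s(t)=\frac{1}{\sqrt{T'}}\frac{\sin(\pi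 t/T')}{\pi t/T'}$ (for almost every $t$). 4. $X(t)$ is well localized in time, in the following senses. (a) If $x=(x_k)_{k\in\mathbb Z}$ is a nonzero real sequence with $\sum_k x_k^2<\infty$ and $X=(x_{-n},\dots,x_n)$, then $K_D(X(t),\Omega_n)\to1$ as $n\to\infty$. (b) For every $\mu>0$ there is $N$ such that for all $n\ge N$ and every random vector $X$ in $\mathbb R^{2n+1}$ with $\mathbf E X_k^2=v$ for all $k$ and $\mathbf E X_kX_\ell=0$ for $k\ne\ell$ (for some $0<v<\infty$), $\mathbf E\int_{\Omega_n}|X(t)|^2dt\ge(1-\mu)\,\mathbf E\|X(t)\|^2$. (c) If the entries of $X$ are independent and identically distributed with a law, not depending on $n$, of mean zero and finite nonzero variance, then for every $\mu>0$ the probability that $K_D(X(t),\Omega_n)\ge1-\mu$ tends to $1$ as $n\to\infty$. (d) If moreover $G$ itself is piecewise continuously differentiable and $|G|$ is bounded away from $0$ on $|\omega|\le2\pi W'$, then for every $\mu>0$ there is $K>0$ such that $K_D(X(t),[-KnT',KnT'])\ge1-\mu$ for all $n\ge1$ and all nonzero $X\in\mathbb R^{2n+1}$. -/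

import Mathlib

open MeasureTheory Filter Topology
open scoped ComplexOrder MatrixOrder FourierTransform ENNReal ComplexConjugate

namespace PrecodedFTN

noncomputable section

/-- `G` represents the `L²` (Plancherel) Fourier transform of the square integrable function `g`
in the angular-frequency convention `G(ω) = ∫ g(t) e^{-iωt} dt`. -/
def IsL2FourierTransform (g G : ℝ → ℂ) : Prop :=
  ∃ hg : MemLp g 2 (volume : Measure ℝ),
    G =ᵐ[volume] fun ω : ℝ =>
      ((𝓕 (hg.toLp g) : Lp ℂ 2 (volume : Measure ℝ)) : ℝ → ℂ) (ω / (2 * Real.pi))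

/-- Piecewise continuous differentiability: `f` is `C¹` off a finite set of break points, and at
every break point `f` and `f'` have finite one-sided limits. Jumps are allowed. -/
def PiecewiseC1 {E : Type*} [NormedAddCommGroup E] [NormedSpace ℝ E] (f : ℝ → E) : Prop :=
  ∃ S : Finset ℝ,
    (∀ x, x ∉ S → ContDiffAt ℝ 1 f x) ∧
    ∀ x ∈ S,
      (∃ a, Tendsto f (𝓝[<] x) (𝓝 a)) ∧ (∃ a, Tendsto f (𝓝[>] x) (𝓝 a)) ∧
      (∃ a, Tendsto (deriv f) (𝓝[<] x) (𝓝 a)) ∧ (∃ a, Tendsto (deriv f) (𝓝[>] x) (𝓝 a))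

/-- The indices `-n, …, n`. -/
abbrev Idx (n : ℕ) : Type := {k : ℤ // k ∈ Finset.Icc (-(n : ℤ)) (n : ℤ)}

/-- The shifted pulse `h_k(t) = g(t - kT)`. -/
def shifted (g : ℝ → ℂ) (T : ℝ) (k : ℤ) (t : ℝ) : ℂ := g (t - k * T)

/-- The Gram matrix `H_{2n+1}`, with entries `⟨h_k, h_l⟩ = ∫ h_k(t) conj(h_l(t)) dt`. -/
def gram (g : ℝ → ℂ) (T : ℝ) (n : ℕ) : Matrix (Idx n) (Idx n) ℂ :=
  Matrix.of fun k l => ∫ t : ℝ, shifted g T k t * conj (shifted g T l t)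

/-- The precoded symbols `A = H_{2n+1}^{-1/2} X`. -/
def precode (g : ℝ → ℂ) (T : ℝ) (n : ℕ) (X : Idx n → ℝ) : Idx n → ℂ :=
  Matrix.mulVec (CFC.sqrt (gram g T n))⁻¹ fun k => (X k : ℂ)

/-- The transmitted signal `X(t) = ∑_{k=-n}^{n} A_k h_k(t)`. -/
def signal (g : ℝ → ℂ) (T : ℝ) (n : ℕ) (X : Idx n → ℝ) (t : ℝ) : ℂ :=
  ∑ k : Idx n, precode g T n X k * shifted g T k t

/-- The effective pulse of the `l`-th symbol: the signal sent for the `l`-th unit vector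
(and zero if `l` is not one of the indices `-n, …, n`). -/
def effectivePulse (g : ℝ → ℂ) (T : ℝ) (n : ℕ) (l : ℤ) : ℝ → ℂ :=
  signal g T n fun k => if (k : ℤ) = l then 1 else 0

/-- The energy of a signal in a set of times. -/
def energyIn (f : ℝ → ℂ) (Ω : Set ℝ) : ℝ := ∫ t in Ω, ‖f t‖ ^ 2

/-- The total energy of a signal. -/
def energy (f : ℝ → ℂ) : ℝ := ∫ t : ℝ, ‖f t‖ ^ 2

/-- The time concentration `K_D(f, Ω)`: the fraction of the energy of `f` that lies in `Ω`. -/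
def concentration (f : ℝ → ℂ) (Ω : Set ℝ) : ℝ := energyIn f Ω / energy f

/-- The time interval `[-nT, nT]` spanned by the centres of the `2n+1` pulses. -/
def window (T : ℝ) (n : ℕ) : Set ℝ := Set.Icc (-(n * T)) (n * T)

end

end PrecodedFTN

/-!
Write `Γ(ξ) = G(2πξ)`. On the Fourier side the pulse `h_k` is `e^{-2πikTξ} Γ = M e_k`, where `M` is
multiplication by `|Γ|/√T` and `e_k = √T e^{-2πikTξ} Γ/|Γ|` is an orthonormal basis of the
`L²` functions on the band, because `T = 1/(2W)` is the Nyquist period. The `e_k` are the spectra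
of the shifts by `kT` of one pulse `s`, which is the pulse in the limit (`limitPulse`).

Let `V` be the synthesis operator `a ↦ ∑_{|k| ≤ n} a_k M e_k`. Its Gram matrix is `H = V⋆V`, which
is invertible because `M` is injective on the band, and the effective pulses are the columns of the
isometry `U = V (V⋆V)^{-1/2}` of the polar decomposition `V = (VV⋆)^{1/2} U`. Here
`VV⋆ = M P_n M` with the projection `P_n` to the span of the `e_k`, `|k| ≤ n`. It converges
strongly to `M²`, and so does `(VV⋆)^{1/2}` to `M`. Hence `M U δ_l` is close to `V δ_l = M e_l`, if
tested against a fixed vector `χ`, and the vectors `M χ` are dense in the functions on the band. As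
`U δ_l` and `e_l` are unit vectors, they are close in norm. Since `M` commutes with modulations, the
estimate for the index `l` in the block `-n, …, n` is that for the index `0` in the block
`-n-l, …, n-l`, so it is uniform in all `l` with `n - |l|` large. This is
`exists_norm_sum_inv_sqrt_gram_sub_le`, in which the square root is replaced by polynomial
approximations of it to stay within algebra and strong limits.

Everything else but the last claim follows from this uniform statement (`HasLimitPulse`) and from
the isometry of the precoding. The tails of `s(· - lT)` outside `[-nT, nT]` are small when `n - |l|`
is large, so the mean over `|l| ≤ n` of the energies of the effective pulses outside the window
tends to zero (`tendsto_average_energyIn_compl`). For uncorrelated data of equal power the mean energy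
outside the window is this quantity times the mean total energy. For independent identically
distributed data, Markov's inequality bounds the energy outside, and Chebyshev's inequality for
the truncated squares of the symbols bounds the total energy from below.

For a piecewise `C¹` spectrum `G` the pulse is `O(1/|t|)` (`exists_norm_pulse_le`), and if `|G|` is
bounded below the precoded symbols are bounded in `ℓ²` by the data. By the Cauchy–Schwarz inequality
the signal is then `O(√n/|t|)` far away from the block, which gives the uniform localization
(`exists_concentration_ge`).
-/

namespace PrecodedFTN

/-! ### Polar decomposition of the synthesis operator of finitely many vectors -/

open Polynomial in
/-- A real polynomial `p` with `p(x²) ≈ x` on `[0, R]` satisfies `p(a²) ≈ a` for every positive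
element `a` of norm at most `R` of a C⋆-algebra. -/
theorem norm_aeval_sq_sub_le {A : Type*} [CStarAlgebra A] [PartialOrder A] [StarOrderedRing A]
    {a : A} (ha : 0 ≤ a) {R ε : ℝ} (hR : ‖a‖ ≤ R) (hε : 0 ≤ ε) (p : ℝ[X])
    (hp : ∀ x ∈ Set.Icc 0 R, |p.eval (x ^ 2) - x| ≤ ε) :
    ‖aeval (a ^ 2) p - a‖ ≤ ε := by
  have hsa : IsSelfAdjoint a := ha.isSelfAdjoint
  have h1 : aeval (a ^ 2) p - a = aeval a (p.comp (X ^ 2) - X) := by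
    simp [aeval_comp]
  rw [h1, ← cfc_polynomial _ a hsa]
  refine norm_cfc_le hε fun x hx => ?_
  have hx0 : 0 ≤ x := spectrum_nonneg_of_nonneg ha hx
  have : Nontrivial A := by
    by_contra h
    rw [not_nontrivial_iff_subsingleton] at h
    simp at hx
  have hx1 : x ≤ R := (le_abs_self x).trans ((spectrum.norm_le_norm_of_mem hx).trans hR)
  simpa using hp x ⟨hx0, hx1⟩

section Hilbert

variable {E : Type*} [NormedAddCommGroup E] [InnerProductSpace ℂ E]
variable {ι : Type*} [Fintype ι]

theorem norm_sum_le_of_orthonormal {u : ι → E} (hu : Orthonormal ℂ u) (M : E →L[ℂ] E)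
    (a : ι → ℂ) : ‖∑ i, a i • M (u i)‖ ≤ ‖M‖ * ‖WithLp.toLp 2 a‖ := by
  have h1 : ∑ i, a i • M (u i) = M (∑ i, a i • u i) := by simp
  have h2 : ‖∑ i, a i • u i‖ = ‖WithLp.toLp 2 a‖ := by
    have := hu.inner_sum a a Finset.univ
    rw [inner_self_eq_norm_sq_to_K] at this
    have h3 : ‖∑ i, a i • u i‖ ^ 2 = ‖WithLp.toLp 2 a‖ ^ 2 := by
      rw [EuclideanSpace.norm_sq_eq]
      have h4 : ((‖∑ i, a i • u i‖ ^ 2 : ℝ) : ℂ) = ((∑ i, ‖a i‖ ^ 2 : ℝ) : ℂ) := by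
        push_cast
        simpa [Complex.conj_mul'] using this
      exact_mod_cast h4
    exact (pow_left_inj₀ (norm_nonneg _) (norm_nonneg _) two_ne_zero).1 h3
  rw [h1, ← h2]
  exact M.le_opNorm _

/-- The operator `M P M`, where `P = ∑ᵢ uᵢ ⟨uᵢ, ·⟩`. For the synthesis operator `V` of the vectors
`M uᵢ` it equals `V V⋆`. -/
noncomputable def frameOp (M : E →L[ℂ] E) (u : ι → E) : E →L[ℂ] E :=
  M * (∑ i, InnerProductSpace.rankOne ℂ (u i) (u i)) * M

theorem frameOp_apply (M : E →L[ℂ] E) (u : ι → E) (y : E) :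
    frameOp M u y = ∑ i, inner ℂ (u i) (M y) • M (u i) := by
  simp [frameOp, map_sum]

/-- `(V V⋆) V a = V (V⋆ V) a` for the synthesis operator `V` of the vectors `M uᵢ`. -/
theorem frameOp_sum [CompleteSpace E] {M : E →L[ℂ] E} (hM : IsSelfAdjoint M) (u : ι → E)
    (a : ι → ℂ) :
    frameOp M u (∑ i, a i • M (u i)) =
      ∑ i, ((Matrix.gram ℂ fun i => M (u i)).mulVec a) i • M (u i) := by
  rw [frameOp_apply]
  refine Finset.sum_congr rfl fun i _ => ?_
  congr 1
  have hsym : ∀ x y, inner ℂ (M x) y = inner ℂ x (M y) := fun x y =>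
    (ContinuousLinearMap.isSelfAdjoint_iff_isSymmetric.1 hM) x y
  simp [Matrix.mulVec, dotProduct, Matrix.gram_apply, map_sum, hsym,
    mul_comm]

theorem isSelfAdjoint_frameOp [CompleteSpace E] {M : E →L[ℂ] E} (hM : IsSelfAdjoint M) (u : ι → E) :
    IsSelfAdjoint (frameOp M u) := by
  have hsym : ∀ x y, inner ℂ (M x) y = inner ℂ x (M y) := fun x y =>
    (ContinuousLinearMap.isSelfAdjoint_iff_isSymmetric.1 hM) x y
  rw [ContinuousLinearMap.isSelfAdjoint_iff_isSymmetric]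
  intro x y
  simp only [ContinuousLinearMap.coe_coe, frameOp_apply, sum_inner, inner_sum, inner_smul_left,
    inner_smul_right, inner_conj_symm, hsym]
  exact Finset.sum_congr rfl fun i _ => mul_comm _ _

open Polynomial in
theorem inner_aeval_frameOp [CompleteSpace E] {M : E →L[ℂ] E} (hM : IsSelfAdjoint M) (u : ι → E)
    (p : ℝ[X]) (x y : E) :
    inner ℂ (aeval (frameOp M u) p x) y = inner ℂ x (aeval (frameOp M u) p y) := by
  have : IsSelfAdjoint (aeval (frameOp M u) p) := by
    rw [← cfc_polynomial p _ (isSelfAdjoint_frameOp hM u)]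
    exact cfc_predicate _ _
  exact (ContinuousLinearMap.isSelfAdjoint_iff_isSymmetric.1 this) x y

variable [DecidableEq ι]

/-- If `S² = Gram(v)`, then `x ↦ ∑ᵢ (S⁻¹ x)ᵢ vᵢ` is isometric. -/
theorem inner_sum_inv_sqrt_gram (v : ι → E) {S : Matrix ι ι ℂ} (hS : S.IsHermitian)
    (hSS : S * S = Matrix.gram ℂ v) (hdet : IsUnit S.det) (x y : ι → ℂ) :
    inner ℂ (∑ i, (S⁻¹.mulVec x) i • v i) (∑ i, (S⁻¹.mulVec y) i • v i) = star x ⬝ᵥ y := by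
  rw [← Matrix.star_dotProduct_gram_mulVec, ← hSS, Matrix.star_mulVec, hS.inv.eq,
    ← Matrix.dotProduct_mulVec, Matrix.mulVec_mulVec, Matrix.mulVec_mulVec,
    ← mul_assoc, Matrix.nonsing_inv_mul _ hdet, one_mul, Matrix.mul_nonsing_inv _ hdet,
    Matrix.one_mulVec]

theorem norm_sum_inv_sqrt_gram (v : ι → E) {S : Matrix ι ι ℂ} (hS : S.IsHermitian)
    (hSS : S * S = Matrix.gram ℂ v) (hdet : IsUnit S.det) (x : ι → ℂ) :
    ‖∑ i, (S⁻¹.mulVec x) i • v i‖ = ‖WithLp.toLp 2 x‖ := by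
  have h := inner_sum_inv_sqrt_gram v hS hSS hdet x x
  rw [inner_self_eq_norm_sq_to_K] at h
  have h3 : ‖∑ i, (S⁻¹.mulVec x) i • v i‖ ^ 2 = ‖WithLp.toLp 2 x‖ ^ 2 := by
    rw [EuclideanSpace.norm_sq_eq]
    have h4 : ((‖∑ i, (S⁻¹.mulVec x) i • v i‖ ^ 2 : ℝ) : ℂ) = ((∑ i, ‖x i‖ ^ 2 : ℝ) : ℂ) := by
      push_cast
      simpa [dotProduct, Complex.conj_mul'] using h
    exact_mod_cast h4
  exact (pow_left_inj₀ (norm_nonneg _) (norm_nonneg _) two_ne_zero).1 h3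

open scoped Matrix.Norms.L2Operator in
/-- Equivalently, the Gram matrix of the `M uᵢ` has norm at most `‖M‖²`. -/
theorem norm_sqrt_gram_le {u : ι → E} (hu : Orthonormal ℂ u) (M : E →L[ℂ] E)
    {S : Matrix ι ι ℂ} (hS : S.IsHermitian) (hSS : S * S = Matrix.gram ℂ fun i => M (u i))
    (hdet : IsUnit S.det) : ‖S‖ ≤ ‖M‖ := by
  rw [Matrix.cstar_norm_def]
  refine ContinuousLinearMap.opNorm_le_bound _ (norm_nonneg _) fun x => ?_
  have h := norm_sum_inv_sqrt_gram (fun i => M (u i)) hS hSS hdet (S.mulVec x.ofLp)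
  rw [Matrix.mulVec_mulVec, Matrix.nonsing_inv_mul _ hdet, Matrix.one_mulVec] at h
  have h2 := norm_sum_le_of_orthonormal hu M x.ofLp
  rw [h] at h2
  exact h2

variable [CompleteSpace E]

open Polynomial in
theorem aeval_frameOp_sum {M : E →L[ℂ] E} (hM : IsSelfAdjoint M) (u : ι → E) (p : ℝ[X])
    (a : ι → ℂ) :
    aeval (frameOp M u) p (∑ i, a i • M (u i)) =
      ∑ i, ((aeval (Matrix.gram ℂ fun i => M (u i)) p).mulVec a) i • M (u i) := by
  induction p using Polynomial.induction_on generalizing a with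
  | C r =>
    simp only [aeval_C, Algebra.algebraMap_eq_smul_one, Matrix.smul_mulVec, Matrix.one_mulVec,
      smul_apply, one_apply_eq_self, Finset.smul_sum,
      Pi.smul_apply, smul_assoc]
  | add p q hp hq =>
    simp only [map_add, add_apply, hp, hq, Matrix.add_mulVec, Pi.add_apply,
      add_smul, Finset.sum_add_distrib]
  | monomial n r ih =>
    have e : (C r * X ^ (n + 1) : ℝ[X]) = (C r * X ^ n) * X := by ring
    rw [e, map_mul _ _ X, map_mul _ _ X, aeval_X, aeval_X, mul_apply_eq_comp,
      frameOp_sum hM, ih, Matrix.mulVec_mulVec]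

open Polynomial Matrix.Norms.L2Operator in
/-- Quantitative form of the relation `V = (V V⋆)^{1/2} W` between the synthesis operator `V` of
the vectors `M uᵢ` and the isometry `W = V (V⋆ V)^{-1/2}` of its polar decomposition: the square
root is replaced by a polynomial `p` that approximates it. -/
theorem norm_aeval_frameOp_sum_sub_le {u : ι → E} (hu : Orthonormal ℂ u) {M : E →L[ℂ] E}
    (hM : IsSelfAdjoint M) {S : Matrix ι ι ℂ} (hS : S.PosSemidef)
    (hSS : S * S = Matrix.gram ℂ fun i => M (u i)) (hdet : IsUnit S.det) {ε : ℝ} (hε : 0 ≤ ε)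
    (p : ℝ[X]) (hp : ∀ x ∈ Set.Icc 0 ‖M‖, |p.eval (x ^ 2) - x| ≤ ε) (i : ι) :
    ‖aeval (frameOp M u) p (∑ j, (S⁻¹.mulVec (Pi.single i 1)) j • M (u j)) - M (u i)‖ ≤ ε := by
  have hnorm := norm_aeval_sq_sub_le (Matrix.nonneg_iff_posSemidef.2 hS)
    (norm_sqrt_gram_le hu M hS.isHermitian hSS hdet) hε p hp
  have hcomm : aeval (S ^ 2) p * S⁻¹ = S⁻¹ * aeval (S ^ 2) p := by
    have h1 : Commute (aeval (S ^ 2) p) S := by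
      have h2 : Commute (aeval S (p.comp (X ^ 2))) (aeval S X) :=
        (Commute.all (p.comp (X ^ 2)) (X : ℝ[X])).map (aeval S)
      simpa [aeval_comp] using h2
    calc aeval (S ^ 2) p * S⁻¹ = S⁻¹ * (S * aeval (S ^ 2) p) * S⁻¹ := by
          rw [← mul_assoc, Matrix.nonsing_inv_mul _ hdet, one_mul]
      _ = S⁻¹ * (aeval (S ^ 2) p * (S * S⁻¹)) := by rw [← h1.eq]; simp only [mul_assoc]
      _ = _ := by rw [Matrix.mul_nonsing_inv _ hdet, mul_one]
  have hv : M (u i) = ∑ j, (S⁻¹.mulVec (S.mulVec (Pi.single i 1))) j • M (u j) := by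
    rw [Matrix.mulVec_mulVec, Matrix.nonsing_inv_mul _ hdet, Matrix.one_mulVec]
    rw [Finset.sum_eq_single i] <;> simp +contextual
  rw [aeval_frameOp_sum hM, ← hSS, ← pow_two, Matrix.mulVec_mulVec, hcomm, ← Matrix.mulVec_mulVec]
  conv_lhs => rw [hv]
  rw [← Finset.sum_sub_distrib]
  simp_rw [← sub_smul, ← Pi.sub_apply, ← Matrix.mulVec_sub, ← Matrix.sub_mulVec]
  rw [norm_sum_inv_sqrt_gram (fun i => M (u i)) hS.isHermitian hSS hdet]
  have h5 := Matrix.l2_opNorm_mulVec (aeval (S ^ 2) p - S) (EuclideanSpace.single i (1 : ℂ))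
  rw [PiLp.norm_single, norm_one, mul_one] at h5
  exact h5.trans hnorm

open Polynomial in
/-- A bound for the distance, tested against the vector `M χ`, between `uᵢ` and the `i`-th
column of the isometry in the polar decomposition of the synthesis operator of the `M uⱼ`. -/
theorem norm_inner_sum_sub_le {u : ι → E} (hu : Orthonormal ℂ u) {M : E →L[ℂ] E}
    (hM : 0 ≤ M) {S : Matrix ι ι ℂ} (hS : S.PosSemidef)
    (hSS : S * S = Matrix.gram ℂ fun i => M (u i)) (hdet : IsUnit S.det) {ε : ℝ} (hε : 0 ≤ ε)
    (p : ℝ[X]) (hp : ∀ x ∈ Set.Icc 0 ‖M‖, |p.eval (x ^ 2) - x| ≤ ε) (i : ι) (χ : E) :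
    ‖inner ℂ ((∑ j, (S⁻¹.mulVec (Pi.single i 1)) j • M (u j)) - u i) (M χ)‖ ≤
      2 * ε * ‖χ‖ + ‖aeval (M ^ 2) p χ - aeval (frameOp M u) p χ‖ := by
  have hMs : IsSelfAdjoint M := hM.isSelfAdjoint
  have hsym : ∀ x y, inner ℂ (M x) y = inner ℂ x (M y) := fun x y =>
    (ContinuousLinearMap.isSelfAdjoint_iff_isSymmetric.1 hMs) x y
  set φ := ∑ j, (S⁻¹.mulVec (Pi.single i 1)) j • M (u j) with hφ
  have hφ1 : ‖φ‖ = 1 := by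
    rw [hφ, norm_sum_inv_sqrt_gram (fun i => M (u i)) hS.isHermitian hSS hdet]
    simp
  have h1 := norm_aeval_frameOp_sum_sub_le hu hMs hS hSS hdet hε p hp i
  rw [← hφ] at h1
  have h2 : ‖aeval (M ^ 2) p χ - M χ‖ ≤ ε * ‖χ‖ := by
    refine ((aeval (M ^ 2) p - M).le_opNorm χ).trans ?_
    gcongr
    exact norm_aeval_sq_sub_le hM le_rfl hε p hp
  -- `M χ ≈ p(M²) χ ≈ p(V V⋆) χ`, and `p(V V⋆) φ ≈ M uᵢ`
  have key : inner ℂ (φ - u i) (M χ) =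
      -inner ℂ φ (aeval (M ^ 2) p χ - M χ) +
      inner ℂ φ (aeval (M ^ 2) p χ - aeval (frameOp M u) p χ) +
      inner ℂ (aeval (frameOp M u) p φ - M (u i)) χ := by
    simp only [inner_sub_left, inner_sub_right, inner_aeval_frameOp hMs, hsym]
    ring
  rw [key]
  have n1 := norm_inner_le_norm (𝕜 := ℂ) φ (aeval (M ^ 2) p χ - M χ)
  have n2 := norm_inner_le_norm (𝕜 := ℂ) φ (aeval (M ^ 2) p χ - aeval (frameOp M u) p χ)
  have n3 := norm_inner_le_norm (𝕜 := ℂ) (aeval (frameOp M u) p φ - M (u i)) χ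
  rw [hφ1, one_mul] at n1 n2
  have n4 := mul_le_mul_of_nonneg_right h1 (norm_nonneg χ)
  refine (norm_add₃_le).trans ?_
  rw [norm_neg]
  linarith

end Hilbert

/-! ### Strong convergence of finite sections and the limit of the orthonormalized vectors -/

section StrongLimit

variable {E : Type*} [NormedAddCommGroup E] [InnerProductSpace ℂ E]

/-- The partial sum operator `∑_{j ∈ J} e_j ⟨e_j, ·⟩` of the expansion in the vectors `e_j`. -/
noncomputable def partialSum (e : ℤ → E) (J : Finset ℤ) : E →L[ℂ] E :=
  ∑ j ∈ J, InnerProductSpace.rankOne ℂ (e j) (e j)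

theorem partialSum_eq_starProjection {e : ℤ → E} (he : Orthonormal ℂ e) (J : Finset ℤ)
    [(Submodule.span ℂ (e '' J)).HasOrthogonalProjection] :
    partialSum e J = (Submodule.span ℂ (e '' J)).starProjection := by
  ext y
  symm
  refine Submodule.eq_starProjection_of_mem_of_inner_eq_zero ?_ ?_
  · simp only [partialSum, sum_apply, InnerProductSpace.rankOne_apply]
    exact Submodule.sum_mem _ fun j hj =>
      Submodule.smul_mem _ _ (Submodule.subset_span ⟨j, hj, rfl⟩)
  · intro w hw
    induction hw using Submodule.span_induction with
    | mem x hx =>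
      obtain ⟨j, hj, rfl⟩ := hx
      have hj' : j ∈ J := hj
      simp [partialSum, sum_inner, inner_sub_left, inner_smul_left, orthonormal_iff_ite.1 he, hj']
    | zero => simp
    | add x y _ _ hx hy => rw [inner_add_right, hx, hy, add_zero]
    | smul a x _ hx => rw [inner_smul_right, hx, mul_zero]

theorem frameOp_shift (M : E →L[ℂ] E) (e : ℤ → E) (n : ℕ) (l : ℤ) :
    frameOp M (fun k : Idx n => e (k - l)) =
      M * partialSum e (Finset.Icc (-(n : ℤ) - l) (n - l)) * M := by
  unfold frameOp partialSum
  congr 2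
  rw [Finset.sum_coe_sort (Finset.Icc (-(n : ℤ)) n)
    (fun k => InnerProductSpace.rankOne ℂ (e (k - l)) (e (k - l)))]
  refine Finset.sum_nbij' (fun k => k - l) (fun k => k + l) ?_ ?_ ?_ ?_ ?_ <;> intro k <;>
    simp only [Finset.mem_Icc] <;> grind

theorem norm_partialSum_le {e : ℤ → E} (he : Orthonormal ℂ e) (J : Finset ℤ) :
    ‖partialSum e J‖ ≤ 1 := by
  have : FiniteDimensional ℂ (Submodule.span ℂ (e '' J)) :=
    FiniteDimensional.span_of_finite ℂ (J.finite_toSet.image e)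
  rw [partialSum_eq_starProjection he]
  exact Submodule.starProjection_norm_le _

variable [CompleteSpace E]

/-- If the kernel of the self-adjoint operator `M` is the orthogonal complement of the `e_j`, then
the partial sums of the expansion of `M χ` in the `e_j` converge. -/
theorem tendsto_partialSum {e : ℤ → E} (he : Orthonormal ℂ e) {M : E →L[ℂ] E}
    (hM : IsSelfAdjoint M) (hker : ∀ f, M f = 0 ↔ ∀ k, inner ℂ (e k) f = 0) (χ : E) :
    Tendsto (fun J => partialSum e J (M χ)) atTop (𝓝 (M χ)) := by
  have hfin : ∀ J : Finset ℤ, FiniteDimensional ℂ (Submodule.span ℂ (e '' J)) := fun J =>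
    FiniteDimensional.span_of_finite ℂ (J.finite_toSet.image e)
  have hsym : ∀ x y, inner ℂ (M x) y = inner ℂ x (M y) := fun x y =>
    (ContinuousLinearMap.isSelfAdjoint_iff_isSymmetric.1 hM) x y
  have hmono : Monotone fun J : Finset ℤ => Submodule.span ℂ (e '' J) := fun J J' h =>
    Submodule.span_mono (Set.image_mono (by exact_mod_cast h))
  have ht := Submodule.starProjection_tendsto_closure_iSup
    (fun J : Finset ℤ => Submodule.span ℂ (e '' J)) hmono (M χ)
  have hmem : M χ ∈ (⨆ J : Finset ℤ, Submodule.span ℂ (e '' J)).topologicalClosure := by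
    rw [← Submodule.orthogonal_orthogonal_eq_closure, Submodule.mem_orthogonal]
    intro f hf
    rw [Submodule.mem_orthogonal] at hf
    have : M f = 0 := by
      rw [hker]
      intro k
      refine hf _ (Submodule.mem_iSup_of_mem {k} (Submodule.subset_span ⟨k, by simp, rfl⟩))
    rw [← hsym, this, inner_zero_left]
  rw [Submodule.starProjection_eq_self_iff.2 hmem] at ht
  simpa only [partialSum_eq_starProjection he] using ht

open Polynomial in
/-- The polynomials in `M P_J M` converge strongly to those in `M²`. -/
theorem tendsto_aeval_partialSum {e : ℤ → E} (he : Orthonormal ℂ e) {M : E →L[ℂ] E}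
    (hM : IsSelfAdjoint M) (hker : ∀ f, M f = 0 ↔ ∀ k, inner ℂ (e k) f = 0) (p : ℝ[X]) (χ : E) :
    Tendsto (fun J => aeval (M * partialSum e J * M) p χ) atTop (𝓝 (aeval (M ^ 2) p χ)) := by
  induction p using Polynomial.induction_on with
  | C r => simp only [aeval_C]; exact tendsto_const_nhds
  | add p q hp hq => simpa only [map_add, add_apply] using hp.add hq
  | monomial n r ih =>
    have e1 : (C r * X ^ (n + 1) : ℝ[X]) = X * (C r * X ^ n) := by ring
    rw [e1]
    generalize (C r * X ^ n : ℝ[X]) = q at ih ⊢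
    simp only [map_mul, aeval_X, mul_apply_eq_comp, pow_two]
    set z := aeval (M ^ 2) q χ with hz
    have hz' : aeval (M * M) q χ = z := by rw [hz, pow_two]
    rw [hz']
    have h1 : Tendsto (fun J => M (partialSum e J (M z))) atTop (𝓝 (M (M z))) :=
      (M.continuous.tendsto _).comp (tendsto_partialSum he hM hker z)
    have h2 : Tendsto (fun J => M (partialSum e J (M
        (aeval (M * partialSum e J * M) q χ - z)))) atTop (𝓝 0) := by
      have h3 : Tendsto (fun J => ‖M‖ * (1 * (‖M‖ *
          ‖aeval (M * partialSum e J * M) q χ - z‖))) atTop (𝓝 0) := by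
        have := ((((tendsto_iff_norm_sub_tendsto_zero.1 ih).const_mul ‖M‖).const_mul 1).const_mul
          ‖M‖)
        simpa using this
      refine squeeze_zero_norm (fun J => ?_) h3
      refine (M.le_opNorm _).trans ?_
      gcongr
      refine ((partialSum e J).le_opNorm _).trans ?_
      gcongr
      · exact norm_partialSum_le he J
      · exact M.le_opNorm _
    simpa using h1.add h2

/-- **Convergence of the symmetrically orthonormalized system.** Let `e_k`, `k ∈ ℤ`, be orthonormal
and `M` a positive operator whose kernel is the orthogonal complement of the `e_k` and which is of
Toeplitz type with respect to the `e_k`, as is its square. If the vectors `M e_k`, `|k| ≤ n`, are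
orthonormalized by the inverse square root of their Gram matrix, then the `l`-th of the resulting
vectors is close to `e_l`, uniformly in `n` and `l`, as soon as `n - |l|` is large. -/
theorem exists_norm_sum_inv_sqrt_gram_sub_le {e : ℤ → E} (he : Orthonormal ℂ e) {M : E →L[ℂ] E}
    (hM : 0 ≤ M) (hker : ∀ f, M f = 0 ↔ ∀ k, inner ℂ (e k) f = 0)
    (hT1 : ∀ k j l, inner ℂ (M (e (k - l))) (e (j - l)) = inner ℂ (M (e k)) (e j))
    (hT2 : ∀ k j l, inner ℂ (M (e (k - l))) (M (e (j - l))) = inner ℂ (M (e k)) (M (e j)))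
    {ε : ℝ} (hε : 0 < ε) :
    ∃ m : ℕ, ∀ (n : ℕ) (l : Idx n), |(l : ℤ)| + m ≤ n → ∀ S : Matrix (Idx n) (Idx n) ℂ,
      S.PosSemidef → S * S = Matrix.gram ℂ (fun k : Idx n => M (e k)) → IsUnit S.det →
        ‖(∑ j, (S⁻¹.mulVec (Pi.single l 1)) j • M (e j)) - e l‖ ^ 2 ≤ ε := by
  have hMs : IsSelfAdjoint M := hM.isSelfAdjoint
  have hsym : ∀ x y, inner ℂ (M x) y = inner ℂ x (M y) := fun x y =>
    (ContinuousLinearMap.isSelfAdjoint_iff_isSymmetric.1 hMs) x y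
  have hδ : 0 < ε / 8 := by positivity
  -- `e₀` is orthogonal to the kernel of `M`, hence in the closure of the range of `M`
  obtain ⟨χ, hχ⟩ : ∃ χ, ‖e 0 - M χ‖ < ε / 8 := by
    have hmem : e 0 ∈ M.range.topologicalClosure := by
      have := ContinuousLinearMap.orthogonal_ker M
      rw [hMs.adjoint_eq] at this
      rw [← this, Submodule.mem_orthogonal']
      intro f hf
      exact (hker f).1 hf 0
    obtain ⟨y, ⟨χ, rfl⟩, hy⟩ := Metric.mem_closure_iff.1 hmem _ hδ
    exact ⟨χ, by simpa [dist_eq_norm] using hy⟩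
  set η := ε / 8 / (2 * (‖χ‖ + 1)) with hη
  have hη0 : 0 < η := by positivity
  have hηχ : 2 * η * ‖χ‖ ≤ ε / 8 := by
    rw [hη, mul_div_assoc', div_mul_eq_mul_div, div_le_iff₀ (by positivity)]
    nlinarith [norm_nonneg χ]
  obtain ⟨p, hp⟩ := exists_polynomial_near_of_continuousOn 0 (‖M‖ ^ 2) Real.sqrt
    Real.continuous_sqrt.continuousOn η hη0
  have hp' : ∀ x ∈ Set.Icc 0 ‖M‖, |p.eval (x ^ 2) - x| ≤ η := fun x hx => by
    have := hp (x ^ 2) ⟨sq_nonneg x, pow_le_pow_left₀ hx.1 hx.2 2⟩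
    rw [Real.sqrt_sq hx.1] at this
    exact this.le
  obtain ⟨J, hJ⟩ := eventually_atTop.1
    ((Metric.tendsto_nhds.1 (tendsto_aeval_partialSum he hMs hker p χ)) _ hδ)
  refine ⟨J.sup Int.natAbs, fun n l hl S hS hSS hdet => ?_⟩
  have hu : Orthonormal ℂ fun k : Idx n => e (k - l) :=
    he.comp _ fun a b h => Subtype.ext (by simpa using h)
  have hSS' : S * S = Matrix.gram ℂ fun k : Idx n => M (e (k - l)) := by
    rw [hSS]; ext i j; simp [Matrix.gram_apply, hT2]
  have hsub : J ≤ Finset.Icc (-(n : ℤ) - l) (n - l) := fun k hk => by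
    have : k.natAbs ≤ J.sup Int.natAbs := Finset.le_sup hk
    rw [Finset.mem_Icc]
    have h1 : |k| ≤ (J.sup Int.natAbs : ℕ) := by rw [Int.abs_eq_natAbs]; exact_mod_cast this
    have := abs_le.1 h1
    have h2 := le_abs_self (l : ℤ)
    have h3 := neg_abs_le (l : ℤ)
    constructor <;> linarith
  set a := S⁻¹.mulVec (Pi.single l 1) with ha
  have h1 := norm_inner_sum_sub_le hu hM hS hSS' hdet hη0.le p hp' l χ
  have h2 := hJ _ hsub
  rw [← frameOp_shift M e n l, dist_eq_norm, norm_sub_rev] at h2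
  rw [← ha] at h1
  have hφ : ‖∑ j, a j • M (e (j - l))‖ = 1 := by
    rw [ha, norm_sum_inv_sqrt_gram (fun k : Idx n => M (e (k - l))) hS.isHermitian hSS' hdet]
    simp
  have hψ : ‖∑ j, a j • M (e j)‖ = 1 := by
    rw [ha, norm_sum_inv_sqrt_gram (fun k : Idx n => M (e k)) hS.isHermitian hSS hdet]
    simp
  -- by the Toeplitz property the matrix `S` is also the square root of the Gram matrix of the
  -- translated vectors `M e_{j-l}`, so the `l`-th vector may be moved to the index `0`
  have hinner : inner ℂ (∑ j, a j • M (e j)) (e l) = inner ℂ (∑ j, a j • M (e (j - l))) (e 0) := by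
    simp only [sum_inner, inner_smul_left]
    refine Finset.sum_congr rfl fun j _ => ?_
    rw [← hT1 j l l, sub_self]
  simp only [sub_self] at h1
  set φ := ∑ j, a j • M (e (j - l))
  set ψ := ∑ j, a j • M (e j)
  have he1 : ∀ k, ‖e k‖ = 1 := he.1
  -- `ψ` and `e l` are unit vectors, so their distance is controlled by their inner product
  have h3 : ‖ψ - e l‖ ^ 2 = -2 * (inner ℂ (φ - e 0) (e 0)).re := by
    have h4 := @norm_sub_sq ℂ E _ _ _ ψ (e l)
    rw [h4, hψ, he1, hinner, inner_sub_left, inner_self_eq_norm_sq_to_K, he1]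
    simp
    ring
  have h5 : (inner ℂ (φ - e 0) (e 0)) =
      inner ℂ (φ - e 0) (M χ) + inner ℂ (φ - e 0) (e 0 - M χ) := by
    rw [← inner_add_right, add_sub_cancel]
  have h6 : ‖inner ℂ (φ - e 0) (e 0 - M χ)‖ ≤ 2 * (ε / 8) := by
    refine (norm_inner_le_norm _ _).trans ?_
    gcongr
    refine (norm_sub_le _ _).trans ?_
    rw [hφ, he1]; norm_num
  have h7 : ‖inner ℂ (φ - e 0) (e 0)‖ ≤ 4 * (ε / 8) := by
    rw [h5]
    refine (norm_add_le _ _).trans ?_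
    linarith
  rw [h3]
  have := (abs_le.1 ((Complex.abs_re_le_norm _).trans h7)).1
  linarith

end StrongLimit

/-! ### The `L²` Fourier transform -/

section Fourier

theorem integral_fourier_smul_eq {f h : ℝ → ℂ} (hf : Integrable f) (hh : Integrable h) :
    ∫ x, 𝓕 f x • h x = ∫ x, f x • 𝓕 h x := by
  simpa using! VectorFourier.integral_fourierIntegral_smul_eq_flip (L := innerₗ ℝ)
    (μ := volume) (ν := volume) Real.continuous_fourierChar continuous_inner hf hh

theorem integral_fourierInv_smul_eq {f h : ℝ → ℂ} (hf : Integrable f) (hh : Integrable h) :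
    ∫ x, 𝓕⁻ f x • h x = ∫ x, f x • 𝓕⁻ h x := by
  have h1 : 𝓕⁻ f = 𝓕 fun x => f (-x) := Real.fourierInv_eq_fourier_comp_neg f
  rw [h1, integral_fourier_smul_eq hf.comp_neg hh, ← integral_neg_eq_self]
  simp [Real.fourierInv_eq_fourier_neg]

/-- A square integrable function whose integrals against Schwartz functions agree with those of a
continuous function is a.e. equal to it. -/
theorem ae_eq_of_integral_schwartz {f h : ℝ → ℂ} (hf : MemLp f 2) (hh : Continuous h)
    (H : ∀ φ : SchwartzMap ℝ ℂ, ∫ x, φ x • f x = ∫ x, φ x • h x) : f =ᵐ[volume] h := by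
  have hfl : LocallyIntegrable f := hf.locallyIntegrable (by norm_num)
  have hl : LocallyIntegrable (f - h) := hfl.sub hh.locallyIntegrable
  have := ae_eq_zero_of_integral_contDiff_smul_eq_zero hl fun φ hφ hφc => by
    have hφ' : ContDiff ℝ (⊤ : ℕ∞) fun x => (φ x : ℂ) := Complex.ofRealCLM.contDiff.comp hφ
    have hφc' : HasCompactSupport fun x => (φ x : ℂ) :=
      hφc.comp_left (g := fun x : ℝ => (x : ℂ)) rfl
    have h1 := H (hφc'.toSchwartzMap hφ')
    simp only [HasCompactSupport.toSchwartzMap_toFun, smul_eq_mul] at h1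
    have e : ∀ x, φ x • (f - h) x = (φ x : ℂ) * f x - (φ x : ℂ) * h x := fun x => by
      simp [mul_sub]
    simp_rw [e]
    rw [integral_sub, h1, sub_self]
    · simpa using hfl.integrable_smul_left_of_hasCompactSupport hφ.continuous hφc
    · simpa using hh.locallyIntegrable.integrable_smul_left_of_hasCompactSupport hφ.continuous hφc
  filter_upwards [this] with x hx
  simpa [sub_eq_zero] using hx

theorem continuous_fourier {f : ℝ → ℂ} (hf : Integrable f) : Continuous (𝓕 f) :=
  VectorFourier.fourierIntegral_continuous Real.continuous_fourierChar continuous_inner hf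

theorem continuous_fourierInv {f : ℝ → ℂ} (hf : Integrable f) : Continuous (𝓕⁻ f) := by
  rw [Real.fourierInv_eq_fourier_comp_neg]
  exact continuous_fourier hf.comp_neg

/-- For integrable functions, the `L²` Fourier transform is the Fourier integral. -/
theorem fourier_toLp_ae_eq {f : ℝ → ℂ} (hf : Integrable f) (hf2 : MemLp f 2) :
    (𝓕 (hf2.toLp f) : Lp ℂ 2 (volume : Measure ℝ)) =ᵐ[volume] 𝓕 f := by
  refine ae_eq_of_integral_schwartz (Lp.memLp _) (continuous_fourier hf) fun φ => ?_
  rw [← Lp.toTemperedDistribution_apply, ← Lp.fourier_toTemperedDistribution_eq,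
    TemperedDistribution.fourier_apply, Lp.toTemperedDistribution_apply]
  rw [← integral_fourier_smul_eq φ.integrable hf, ← SchwartzMap.fourier_coe]
  refine integral_congr_ae ?_
  filter_upwards [hf2.coeFn_toLp] with x hx
  rw [hx]

theorem fourierInv_toLp_ae_eq {f : ℝ → ℂ} (hf : Integrable f) (hf2 : MemLp f 2) :
    (𝓕⁻ (hf2.toLp f) : Lp ℂ 2 (volume : Measure ℝ)) =ᵐ[volume] 𝓕⁻ f := by
  refine ae_eq_of_integral_schwartz (Lp.memLp _) (continuous_fourierInv hf) fun φ => ?_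
  rw [← Lp.toTemperedDistribution_apply, ← Lp.fourierInv_toTemperedDistribution_eq,
    TemperedDistribution.fourierInv_apply, Lp.toTemperedDistribution_apply]
  rw [← integral_fourierInv_smul_eq φ.integrable hf, ← SchwartzMap.fourierInv_coe]
  refine integral_congr_ae ?_
  filter_upwards [hf2.coeFn_toLp] with x hx
  rw [hx]

theorem quasiMeasurePreserving_const_mul {c : ℝ} (hc : c ≠ 0) :
    Measure.QuasiMeasurePreserving (fun x : ℝ => c * x) := by
  refine ⟨measurable_const_mul c, ?_⟩
  rw [Real.map_volume_mul_left hc]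
  exact Measure.smul_absolutelyContinuous

/-- In the frequency variable `ξ = ω / 2π`, `G` is the `L²` Fourier transform of `g`. -/
theorem isL2FourierTransform_iff {g G : ℝ → ℂ} :
    IsL2FourierTransform g G ↔ ∃ hg : MemLp g 2 (volume : Measure ℝ),
      (fun ξ => G (2 * Real.pi * ξ)) =ᵐ[volume]
        ((𝓕 (hg.toLp g) : Lp ℂ 2 (volume : Measure ℝ)) : ℝ → ℂ) := by
  have hpi : (2 * Real.pi) ≠ 0 := by positivity
  refine exists_congr fun hg => ⟨fun h => ?_, fun h => ?_⟩
  · have := (quasiMeasurePreserving_const_mul hpi).ae_eq_comp h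
    filter_upwards [this] with ξ hξ
    simp only [Function.comp_apply] at hξ
    rw [hξ, mul_div_cancel_left₀ _ hpi]
  · have := (quasiMeasurePreserving_const_mul (inv_ne_zero hpi)).ae_eq_comp h
    filter_upwards [this] with ω hω
    simp only [Function.comp_apply] at hω
    rw [mul_inv_cancel_left₀ hpi, inv_mul_eq_div] at hω
    exact hω

theorem measurePreserving_sub_const (a : ℝ) :
    MeasurePreserving (fun t : ℝ => t - a) volume volume := measurePreserving_sub_right volume a

theorem memLp_shifted {g : ℝ → ℂ} (hg : MemLp g 2) (T : ℝ) (k : ℤ) :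
    MemLp (shifted g T k) 2 :=
  hg.comp_measurePreserving (measurePreserving_sub_const (k * T))

/-- The modulation `ξ ↦ e^{-2πi k T ξ}`. -/
noncomputable def modulation (T : ℝ) (k : ℤ) (ξ : ℝ) : ℂ :=
  Complex.exp (((-(2 * Real.pi * k * T * ξ) : ℝ) : ℂ) * Complex.I)

theorem continuous_modulation (T : ℝ) (k : ℤ) : Continuous (modulation T k) := by
  unfold modulation; fun_prop

theorem norm_modulation (T : ℝ) (k : ℤ) (ξ : ℝ) : ‖modulation T k ξ‖ = 1 :=
  Complex.norm_exp_ofReal_mul_I _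

theorem conj_modulation_mul (T : ℝ) (k j : ℤ) (ξ : ℝ) :
    conj (modulation T k ξ) * modulation T j ξ = modulation T (j - k) ξ := by
  unfold modulation
  rw [← Complex.exp_conj, ← Complex.exp_add]
  congr 1
  simp only [map_mul, Complex.conj_ofReal, Complex.conj_I]
  push_cast
  ring

theorem memLp_modulation (T : ℝ) (k : ℤ) : MemLp (modulation T k) ∞ :=
  memLp_top_of_bound (continuous_modulation T k).aestronglyMeasurable 1
    (ae_of_all _ fun ξ => (norm_modulation T k ξ).le)

theorem fourier_shifted (g : ℝ → ℂ) (T : ℝ) (k : ℤ) (ξ : ℝ) :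
    𝓕 (shifted g T k) ξ = modulation T k ξ * 𝓕 g ξ := by
  have := congrFun (VectorFourier.fourierIntegral_comp_add_right Real.fourierChar volume
    (innerₗ ℝ) g (-(k * T))) ξ
  have h2 : 𝓕 (shifted g T k) ξ = Real.fourierChar (inner ℝ (-(k * T)) ξ) • 𝓕 g ξ := this
  rw [h2, Circle.smul_def, Real.fourierChar_apply, smul_eq_mul]
  congr 2
  simp
  ring

/-- A shift in time is a modulation in frequency. -/
theorem fourier_shifted_ae_eq {g : ℝ → ℂ} (hg : MemLp g 2) (T : ℝ) (k : ℤ) :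
    (𝓕 ((memLp_shifted hg T k).toLp (shifted g T k)) : Lp ℂ 2 (volume : Measure ℝ)) =ᵐ[volume]
      fun ξ => modulation T k ξ * (𝓕 (hg.toLp g) : Lp ℂ 2 (volume : Measure ℝ)) ξ := by
  have hmp := measurePreserving_sub_const (k * T)
  set m : Lp ℂ ∞ (volume : Measure ℝ) := (memLp_modulation T k).toLp _ with hm
  set B := (ContinuousLinearMap.lsmul ℂ ℂ (E := ℂ)).holderL (volume : Measure ℝ) ∞ 2 2 m with hB
  have hBae : ∀ f : Lp ℂ 2 (volume : Measure ℝ), B f =ᵐ[volume]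
      fun ξ => modulation T k ξ * f ξ := by
    intro f
    filter_upwards [(ContinuousLinearMap.lsmul ℂ ℂ (E := ℂ)).coeFn_holder (r := 2) m f,
      (memLp_modulation T k).coeFn_toLp] with ξ h1 h2
    refine h1.trans ?_
    rw [hm, h2]
    rfl
  have key : ∀ f : Lp ℂ 2 (volume : Measure ℝ),
      (𝓕 (Lp.compMeasurePreserving _ hmp f) : Lp ℂ 2 (volume : Measure ℝ)) = B (𝓕 f) := by
    intro f
    refine DenseRange.induction_on
      (p := fun f : Lp ℂ 2 (volume : Measure ℝ) =>
        (𝓕 (Lp.compMeasurePreserving _ hmp f) : Lp ℂ 2 (volume : Measure ℝ)) = B (𝓕 f))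
      (SchwartzMap.denseRange_toLpCLM (p := 2) ENNReal.ofNat_ne_top) f ?_ ?_
    · refine isClosed_eq ?_ ?_
      · exact (Lp.fourierTransformₗᵢ ℝ ℂ).continuous.comp
          (Lp.isometry_compMeasurePreserving hmp).continuous
      · exact B.continuous.comp (Lp.fourierTransformₗᵢ ℝ ℂ).continuous
    · intro φ
      have hφ2 : MemLp φ 2 := φ.memLp 2
      have e1 : Lp.compMeasurePreserving _ hmp (SchwartzMap.toLpCLM ℝ ℂ 2 volume φ) =
          (memLp_shifted hφ2 T k).toLp (shifted φ T k) :=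
        Lp.toLp_compMeasurePreserving hφ2 hmp
      have hsi : Integrable (shifted φ T k) := hmp.integrable_comp_of_integrable φ.integrable
      rw [e1]
      refine Lp.ext ?_
      have e2 : (SchwartzMap.toLpCLM ℝ ℂ 2 volume φ) = hφ2.toLp φ := rfl
      rw [e2]
      filter_upwards [fourier_toLp_ae_eq hsi (memLp_shifted hφ2 T k),
        fourier_toLp_ae_eq φ.integrable hφ2, hBae (𝓕 (hφ2.toLp φ))] with ξ h1 h2 h3
      rw [h1, h3, h2, fourier_shifted]
  have e3 : (memLp_shifted hg T k).toLp (shifted g T k) =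
      Lp.compMeasurePreserving _ hmp (hg.toLp g) :=
    (Lp.toLp_compMeasurePreserving hg hmp).symm
  rw [e3, key]
  exact hBae _

end Fourier

/-! ### Spectra that vanish exactly off a band -/

section Spectrum

/-- A bounded measurable spectrum `Γ`, as a function of the frequency `ξ`, that vanishes exactly
off the band `|ξ| ≤ W`. -/
structure IsBandSpectrum (Γ : ℝ → ℂ) (W : ℝ) : Prop where
  pos : 0 < W
  aestronglyMeasurable : AEStronglyMeasurable Γ volume
  bounded : ∃ C, ∀ ξ, ‖Γ ξ‖ ≤ C
  ne_zero : ∀ ξ, |ξ| ≤ W → Γ ξ ≠ 0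
  eq_zero : ∀ ξ, W < |ξ| → Γ ξ = 0

/-- The spectrum with the phase of `Γ` and the constant amplitude `√T` on the band. Off the band it
is `0`, as `0 / 0 = 0`. -/
noncomputable def flatSpectrum (Γ : ℝ → ℂ) (T : ℝ) (ξ : ℝ) : ℂ :=
  (Real.sqrt T : ℂ) * (Γ ξ / (‖Γ ξ‖ : ℂ))

variable {Γ : ℝ → ℂ} {W : ℝ}

theorem conj_flatSpectrum_mul_self {T : ℝ} (hT : 0 ≤ T) {ξ : ℝ} (hξ : Γ ξ ≠ 0) :
    conj (flatSpectrum Γ T ξ) * flatSpectrum Γ T ξ = T := by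
  have h1 : (‖Γ ξ‖ : ℂ) ≠ 0 := by simpa using hξ
  have h2 : ((Real.sqrt T : ℝ) : ℂ) * (Real.sqrt T : ℝ) = T := by
    rw [← Complex.ofReal_mul, Real.mul_self_sqrt hT]
  have h3 : conj (Γ ξ) * Γ ξ = (‖Γ ξ‖ : ℂ) ^ 2 := Complex.conj_mul' _
  unfold flatSpectrum
  simp only [map_mul, map_div₀, Complex.conj_ofReal]
  calc _ = (((Real.sqrt T : ℝ) : ℂ) * (Real.sqrt T : ℝ)) *
        ((conj (Γ ξ) * Γ ξ) / (‖Γ ξ‖ : ℂ) ^ 2) := by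
        ring
    _ = T := by rw [h2, h3, div_self (pow_ne_zero 2 h1), mul_one]

theorem norm_flatSpectrum_le (T ξ : ℝ) : ‖flatSpectrum Γ T ξ‖ ≤ Real.sqrt T := by
  unfold flatSpectrum
  rw [norm_mul, norm_div, Complex.norm_real, Complex.norm_real, norm_norm, Real.norm_eq_abs,
    abs_of_nonneg (Real.sqrt_nonneg _)]
  exact mul_le_of_le_one_right (Real.sqrt_nonneg _) (div_self_le_one _)

theorem norm_mul_flatSpectrum {T : ℝ} (hT : 0 < T) (ξ : ℝ) :
    ((‖Γ ξ‖ / Real.sqrt T : ℝ) : ℂ) * flatSpectrum Γ T ξ = Γ ξ := by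
  unfold flatSpectrum
  have h2 : ((Real.sqrt T : ℝ) : ℂ) ≠ 0 := by exact_mod_cast (Real.sqrt_pos.2 hT).ne'
  by_cases h1 : Γ ξ = 0
  · simp [h1]
  · have h1' : (‖Γ ξ‖ : ℂ) ≠ 0 := by simpa using h1
    push_cast
    field_simp

theorem inner_eq_integral {f g : Lp ℂ 2 (volume : Measure ℝ)} {F G : ℝ → ℂ}
    (hf : f =ᵐ[volume] F) (hg : g =ᵐ[volume] G) :
    inner ℂ f g = ∫ ξ, conj (F ξ) * G ξ := by
  rw [L2.inner_def]
  refine integral_congr_ae ?_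
  filter_upwards [hf, hg] with ξ h1 h2
  rw [h1, h2, RCLike.inner_apply, mul_comm]

theorem memLp_of_bound_of_Icc {F : ℝ → ℂ} (hF : AEStronglyMeasurable F volume) {C : ℝ}
    (hC : ∀ ξ, ‖F ξ‖ ≤ C) (h0 : ∀ ξ, ξ ∉ Set.Icc (-W) W → F ξ = 0) (p : ℝ≥0∞) : MemLp F p := by
  have h1 : MemLp F p (volume.restrict (Set.Icc (-W) W)) :=
    MemLp.of_bound hF.restrict C (ae_of_all _ hC)
  have h2 : (Set.Icc (-W) W).indicator F = F :=
    Set.indicator_eq_self.2 fun ξ hξ => by_contra fun h3 => hξ (h0 ξ h3)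
  rw [← h2]
  exact (memLp_indicator_iff_restrict measurableSet_Icc).2 h1

namespace IsBandSpectrum

theorem flatSpectrum_eq_zero (h : IsBandSpectrum Γ W) (T : ℝ) {ξ : ℝ} (hξ : ξ ∉ Set.Icc (-W) W) :
    flatSpectrum Γ T ξ = 0 := by
  have : W < |ξ| := by
    by_contra h2
    exact hξ (abs_le.1 (not_lt.1 h2))
  simp [flatSpectrum, h.eq_zero ξ this]

theorem memLp (h : IsBandSpectrum Γ W) (p : ℝ≥0∞) : MemLp Γ p := by
  obtain ⟨C, hC⟩ := h.bounded
  refine memLp_of_bound_of_Icc (W := W) h.aestronglyMeasurable hC (fun ξ hξ => h.eq_zero ξ ?_) p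
  by_contra h2
  exact hξ (abs_le.1 (not_lt.1 h2))

theorem memLp_flatSpectrum (h : IsBandSpectrum Γ W) (T : ℝ) (p : ℝ≥0∞) :
    MemLp (flatSpectrum Γ T) p := by
  refine memLp_of_bound_of_Icc (W := W) ?_ (norm_flatSpectrum_le T)
    (fun ξ hξ => h.flatSpectrum_eq_zero T hξ) p
  have h1 : AEMeasurable Γ := h.aestronglyMeasurable.aemeasurable
  have h2 : AEMeasurable fun ξ => (‖Γ ξ‖ : ℂ) := Complex.measurable_ofReal.comp_aemeasurable h1.norm
  exact ((h1.div h2).const_mul _).aestronglyMeasurable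

theorem memLp_modulation_mul_flatSpectrum (h : IsBandSpectrum Γ W) (T : ℝ) (k : ℤ) :
    MemLp (fun ξ => modulation T k ξ * flatSpectrum Γ T ξ) 2 := by
  refine memLp_of_bound_of_Icc (W := W) ?_ (C := Real.sqrt T) ?_ ?_ 2
  · exact (continuous_modulation T k).aestronglyMeasurable.mul
      (h.memLp_flatSpectrum T 2).aestronglyMeasurable
  · intro ξ
    rw [norm_mul, norm_modulation, one_mul]
    exact norm_flatSpectrum_le T ξ
  · intro ξ hξ
    rw [h.flatSpectrum_eq_zero T hξ, mul_zero]

theorem memLp_amplitude (h : IsBandSpectrum Γ W) (T : ℝ) :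
    MemLp (fun ξ => ((‖Γ ξ‖ / Real.sqrt T : ℝ) : ℂ)) ∞ := by
  have := ((h.memLp ∞).norm.mul_const (Real.sqrt T)⁻¹).ofReal (K := ℂ)
  simpa [div_eq_mul_inv] using this

end IsBandSpectrum

/-- The spectra `e_k = √T e^{-2πi k T ξ} Γ/|Γ|` of the limiting pulses, as elements of `L²`. -/
noncomputable def basisVec (h : IsBandSpectrum Γ W) (T : ℝ) (k : ℤ) : Lp ℂ 2 (volume : Measure ℝ) :=
  (h.memLp_modulation_mul_flatSpectrum T k).toLp _

/-- Multiplication by the normalized amplitude `|Γ| / √T` on `L²`. -/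
noncomputable def amplitudeOp (h : IsBandSpectrum Γ W) (T : ℝ) :
    Lp ℂ 2 (volume : Measure ℝ) →L[ℂ] Lp ℂ 2 (volume : Measure ℝ) :=
  (ContinuousLinearMap.lsmul ℂ ℂ (E := ℂ)).holderL (volume : Measure ℝ) ∞ 2 2
    ((h.memLp_amplitude T).toLp _)

theorem basisVec_ae_eq (h : IsBandSpectrum Γ W) (T : ℝ) (k : ℤ) :
    basisVec h T k =ᵐ[volume] fun ξ => modulation T k ξ * flatSpectrum Γ T ξ :=
  MemLp.coeFn_toLp _

theorem amplitudeOp_ae_eq (h : IsBandSpectrum Γ W) (T : ℝ) (f : Lp ℂ 2 (volume : Measure ℝ)) :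
    amplitudeOp h T f =ᵐ[volume] fun ξ => ((‖Γ ξ‖ / Real.sqrt T : ℝ) : ℂ) * f ξ := by
  filter_upwards [(ContinuousLinearMap.lsmul ℂ ℂ (E := ℂ)).coeFn_holder (r := 2)
    ((h.memLp_amplitude T).toLp _) f, (h.memLp_amplitude T).coeFn_toLp] with ξ h1 h2
  refine h1.trans ?_
  rw [h2]
  rfl

theorem amplitudeOp_basisVec_ae_eq (h : IsBandSpectrum Γ W) {T : ℝ} (hT : 0 < T) (k : ℤ) :
    amplitudeOp h T (basisVec h T k) =ᵐ[volume] fun ξ => modulation T k ξ * Γ ξ := by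
  filter_upwards [amplitudeOp_ae_eq h T (basisVec h T k), basisVec_ae_eq h T k] with ξ h1 h2
  rw [h1, h2, mul_left_comm, norm_mul_flatSpectrum hT]

theorem amplitudeOp_nonneg (h : IsBandSpectrum Γ W) (T : ℝ) : 0 ≤ amplitudeOp h T := by
  rw [ContinuousLinearMap.nonneg_iff_isPositive, ContinuousLinearMap.isPositive_def']
  constructor
  · rw [ContinuousLinearMap.isSelfAdjoint_iff_isSymmetric]
    intro f g
    simp only [ContinuousLinearMap.coe_coe]
    rw [inner_eq_integral (amplitudeOp_ae_eq h T f) EventuallyEq.rfl,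
      inner_eq_integral EventuallyEq.rfl (amplitudeOp_ae_eq h T g)]
    congr 1
    ext ξ
    simp only [map_mul, Complex.conj_ofReal]
    ring
  · intro f
    rw [ContinuousLinearMap.reApplyInnerSelf_apply,
      inner_eq_integral (amplitudeOp_ae_eq h T f) EventuallyEq.rfl]
    have : (fun ξ => conj (((‖Γ ξ‖ / Real.sqrt T : ℝ) : ℂ) * f ξ) * f ξ) =
        fun ξ => ((‖Γ ξ‖ / Real.sqrt T * ‖f ξ‖ ^ 2 : ℝ) : ℂ) := by
      ext ξ
      rw [map_mul, Complex.conj_ofReal, mul_assoc, Complex.conj_mul']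
      push_cast
      ring
    rw [this, integral_complex_ofReal, RCLike.re_eq_complex_re, Complex.ofReal_re]
    positivity

theorem integral_modulation {T : ℝ} (hT : T = 1 / (2 * W)) (hW : 0 < W) (k : ℤ) :
    ∫ ξ in Set.Icc (-W) W, modulation T k ξ = if k = 0 then (2 * W : ℂ) else 0 := by
  rw [integral_Icc_eq_integral_Ioc, ← intervalIntegral.integral_of_le (by linarith)]
  split_ifs with hk
  · subst hk
    simp [modulation]
    ring
  · have hc : -(2 * Real.pi * k * T : ℂ) * Complex.I ≠ 0 := by
      have : (T : ℂ) ≠ 0 := by rw [hT]; exact_mod_cast (by positivity : (1 / (2 * W)) ≠ 0)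
      simp [hk, this, Real.pi_ne_zero]
    have e : (fun ξ => modulation T k ξ) =
        fun ξ : ℝ => Complex.exp ((-(2 * Real.pi * k * T : ℂ) * Complex.I) * ξ) := by
      ext ξ
      unfold modulation
      congr 1
      push_cast
      ring
    rw [e, integral_exp_mul_complex hc, div_eq_zero_iff]
    left
    have hW' : (W : ℂ) ≠ 0 := by exact_mod_cast hW.ne'
    rw [sub_eq_zero, Complex.exp_eq_exp_iff_exists_int]
    refine ⟨-k, ?_⟩
    rw [hT]
    push_cast
    field_simp
    ring

theorem orthonormal_basisVec (h : IsBandSpectrum Γ W) {T : ℝ} (hT : T = 1 / (2 * W)) :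
    Orthonormal ℂ (basisVec h T) := by
  have hW := h.pos
  have hT0 : 0 < T := by rw [hT]; positivity
  rw [orthonormal_iff_ite]
  intro k j
  rw [inner_eq_integral (basisVec_ae_eq h T k) (basisVec_ae_eq h T j)]
  have e : (fun ξ => conj (modulation T k ξ * flatSpectrum Γ T ξ) *
      (modulation T j ξ * flatSpectrum Γ T ξ)) =
      (Set.Icc (-W) W).indicator fun ξ => (T : ℂ) * modulation T (j - k) ξ := by
    ext ξ
    by_cases hξ : ξ ∈ Set.Icc (-W) W
    · rw [Set.indicator_of_mem hξ, ← conj_modulation_mul,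
        ← conj_flatSpectrum_mul_self hT0.le (h.ne_zero ξ (abs_le.2 hξ)), map_mul]
      ring
    · rw [Set.indicator_of_notMem hξ, h.flatSpectrum_eq_zero T hξ]
      simp
  rw [e, integral_indicator measurableSet_Icc, integral_const_mul, integral_modulation hT hW]
  have h3 : j - k = 0 ↔ k = j := by omega
  simp only [h3]
  split_ifs
  · rw [hT]
    have hW' : (W : ℂ) ≠ 0 := by exact_mod_cast hW.ne'
    push_cast
    field_simp
  · simp

/-- Multiplication operators are of Toeplitz type with respect to the `e_k`. -/
theorem inner_amplitudeOp_basisVec_shift (h : IsBandSpectrum Γ W) (T : ℝ) (k j l : ℤ) :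
    inner ℂ (amplitudeOp h T (basisVec h T (k - l))) (basisVec h T (j - l)) =
      inner ℂ (amplitudeOp h T (basisVec h T k)) (basisVec h T j) := by
  have e : ∀ k, amplitudeOp h T (basisVec h T k) =ᵐ[volume]
      fun ξ => modulation T k ξ * (((‖Γ ξ‖ / Real.sqrt T : ℝ) : ℂ) * flatSpectrum Γ T ξ) := by
    intro k
    filter_upwards [amplitudeOp_ae_eq h T (basisVec h T k), basisVec_ae_eq h T k] with ξ h1 h2
    rw [h1, h2, mul_left_comm]
  rw [inner_eq_integral (e _) (basisVec_ae_eq h T _),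
    inner_eq_integral (e _) (basisVec_ae_eq h T _)]
  congr 1
  ext ξ
  have h1 := conj_modulation_mul T (k - l) (j - l) ξ
  have h2 := conj_modulation_mul T k j ξ
  rw [sub_sub_sub_cancel_right] at h1
  simp only [map_mul]
  linear_combination (conj ((‖Γ ξ‖ / Real.sqrt T : ℝ) : ℂ) * conj (flatSpectrum Γ T ξ) *
    flatSpectrum Γ T ξ) * (h1 - h2)

theorem inner_amplitudeOp_basisVec (h : IsBandSpectrum Γ W) {T : ℝ} (hT : 0 < T) (k j : ℤ) :
    inner ℂ (amplitudeOp h T (basisVec h T k)) (amplitudeOp h T (basisVec h T j)) =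
      ∫ ξ, modulation T (j - k) ξ * (‖Γ ξ‖ ^ 2 : ℝ) := by
  rw [inner_eq_integral (amplitudeOp_basisVec_ae_eq h hT k) (amplitudeOp_basisVec_ae_eq h hT j)]
  congr 1
  ext ξ
  rw [map_mul, mul_mul_mul_comm, conj_modulation_mul, Complex.conj_mul']
  push_cast
  rfl

/-- If `|Γ|` is even, the Gram matrix is real. -/
theorem inner_amplitudeOp_basisVec_comm (h : IsBandSpectrum Γ W) {T : ℝ} (hT : 0 < T)
    (heven : ∀ᵐ ξ : ℝ, ‖Γ (-ξ)‖ = ‖Γ ξ‖) (k j : ℤ) :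
    inner ℂ (amplitudeOp h T (basisVec h T k)) (amplitudeOp h T (basisVec h T j)) =
      inner ℂ (amplitudeOp h T (basisVec h T j)) (amplitudeOp h T (basisVec h T k)) := by
  rw [inner_amplitudeOp_basisVec h hT, inner_amplitudeOp_basisVec h hT, ← integral_neg_eq_self]
  refine integral_congr_ae ?_
  filter_upwards [heven] with ξ hξ
  rw [hξ]
  congr 1
  unfold modulation
  congr 3
  push_cast
  ring

theorem amplitudeOp_eq_zero_iff (h : IsBandSpectrum Γ W) {T : ℝ} (hT : 0 < T)
    (f : Lp ℂ 2 (volume : Measure ℝ)) :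
    amplitudeOp h T f = 0 ↔ ∀ᵐ ξ, ξ ∈ Set.Icc (-W) W → f ξ = 0 := by
  rw [Lp.ext_iff]
  have hs := (Real.sqrt_pos.2 hT).ne'
  constructor
  · intro h1
    filter_upwards [h1, amplitudeOp_ae_eq h T f, Lp.coeFn_zero ℂ 2 (volume : Measure ℝ)]
      with ξ h2 h3 h4 hξ
    rw [h3, h4] at h2
    simpa [hs, h.ne_zero ξ (abs_le.2 hξ)] using h2
  · intro h1
    filter_upwards [h1, amplitudeOp_ae_eq h T f, Lp.coeFn_zero ℂ 2 (volume : Measure ℝ)]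
      with ξ h2 h3 h4
    rw [h3, h4]
    by_cases hξ : ξ ∈ Set.Icc (-W) W
    · simp [h2 hξ]
    · have : W < |ξ| := by
        by_contra h2
        exact hξ (abs_le.1 (not_lt.1 h2))
      simp [h.eq_zero ξ this]

/-- The `e_k` are complete in the functions supported in the band: by Parseval's identity for
Fourier series, the kernel of the amplitude operator is their orthogonal complement. -/
theorem amplitudeOp_eq_zero_iff_inner (h : IsBandSpectrum Γ W) {T : ℝ} (hT : T = 1 / (2 * W))
    (f : Lp ℂ 2 (volume : Measure ℝ)) :
    amplitudeOp h T f = 0 ↔ ∀ k, inner ℂ (basisVec h T k) f = 0 := by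
  have hW := h.pos
  have hT0 : 0 < T := by rw [hT]; positivity
  rw [amplitudeOp_eq_zero_iff h hT0]
  have hinner : ∀ k, inner ℂ (basisVec h T k) f =
      ∫ ξ, conj (modulation T k ξ * flatSpectrum Γ T ξ) * f ξ := fun k =>
    inner_eq_integral (basisVec_ae_eq h T k) EventuallyEq.rfl
  constructor
  · intro h1 k
    rw [hinner]
    refine integral_eq_zero_of_ae ?_
    filter_upwards [h1] with ξ hξ
    by_cases h2 : ξ ∈ Set.Icc (-W) W
    · simp [hξ h2]
    · simp [h.flatSpectrum_eq_zero T h2]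
  · intro h1
    set F : ℝ → ℂ := fun ξ => conj (flatSpectrum Γ T ξ) * f ξ with hF
    have hlt : -W < W := by linarith
    have hFm : MemLp F 2 := by
      have := (Lp.memLp f).mul (p := ∞) (r := 2) (h.memLp_flatSpectrum T ∞).star
      exact this
    have hsum := hasSum_sq_fourierCoeffOn hlt (hFm.restrict (Set.Ioc (-W) W))
    have hcoef : ∀ n, fourierCoeffOn hlt F n = 0 := by
      intro n
      rw [fourierCoeffOn_eq_integral, intervalIntegral.integral_of_le hlt.le,
        ← integral_Icc_eq_integral_Ioc]
      have h2 := h1 (-n)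
      rw [hinner, ← setIntegral_eq_integral_of_forall_compl_eq_zero (s := Set.Icc (-W) W)
        (fun ξ hξ => by rw [h.flatSpectrum_eq_zero T hξ]; simp)] at h2
      rw [← smul_zero (1 / (W - -W)), ← h2]
      congr 2
      ext ξ
      rw [fourier_coe_apply, map_mul, smul_eq_mul, mul_assoc (conj (modulation T (-n) ξ))]
      congr 1
      unfold modulation
      rw [← Complex.exp_conj]
      congr 1
      simp only [map_mul, Complex.conj_ofReal, Complex.conj_I]
      have hW' : (W : ℂ) ≠ 0 := by exact_mod_cast hW.ne'
      rw [hT]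
      push_cast
      have h5 : ((W : ℂ) - -W) ≠ 0 := by
        rw [sub_neg_eq_add, ← two_mul]; exact mul_ne_zero two_ne_zero hW'
      field_simp
      ring
    simp only [hcoef, norm_zero, ne_eq, OfNat.ofNat_ne_zero, not_false_eq_true, zero_pow] at hsum
    have h3 : ∫ ξ in Set.Ioc (-W) W, ‖F ξ‖ ^ 2 = 0 := by
      have := hsum.unique hasSum_zero
      rw [intervalIntegral.integral_of_le hlt.le, smul_eq_mul, mul_eq_zero] at this
      refine this.resolve_left (inv_ne_zero ?_)
      linarith
    rw [integral_eq_zero_iff_of_nonneg (fun ξ => by positivity)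
      (hFm.restrict _).norm.integrable_sq] at h3
    have h4 := (ae_restrict_iff' measurableSet_Ioc).1 h3
    filter_upwards [h4, Measure.ae_ne volume (-W)] with ξ h5 h6 hξ
    have h7 := h5 ⟨lt_of_le_of_ne hξ.1 (Ne.symm h6), hξ.2⟩
    have h8 : F ξ = 0 := by simpa using h7
    rw [hF] at h8
    refine (mul_eq_zero.1 h8).resolve_left fun h9 => ?_
    have := conj_flatSpectrum_mul_self hT0.le (h.ne_zero ξ (abs_le.2 hξ))
    rw [h9, zero_mul] at this
    exact hT0.ne' (by exact_mod_cast this.symm)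

end Spectrum

/-! ### Precoded signals in the frequency domain -/

section Signals

theorem energy_eq_norm_sq {f : ℝ → ℂ} (hf : MemLp f 2) : energy f = ‖hf.toLp f‖ ^ 2 := by
  have h1 : inner ℂ (hf.toLp f) (hf.toLp f) = ∫ t, conj (f t) * f t :=
    inner_eq_integral hf.coeFn_toLp hf.coeFn_toLp
  rw [inner_self_eq_norm_sq_to_K] at h1
  have h2 : (fun t => conj (f t) * f t) = fun t => ((‖f t‖ ^ 2 : ℝ) : ℂ) := by
    ext t; rw [Complex.conj_mul']; push_cast; rfl
  rw [h2, integral_complex_ofReal] at h1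
  have h3 : ((energy f : ℝ) : ℂ) = ((‖hf.toLp f‖ ^ 2 : ℝ) : ℂ) := by
    rw [energy, ← h1]
    push_cast
    rfl
  exact_mod_cast h3

theorem memLp_signal {g : ℝ → ℂ} (hg : MemLp g 2) (T : ℝ) (n : ℕ) (X : Idx n → ℝ) :
    MemLp (signal g T n X) 2 :=
  memLp_finsetSum _ fun k _ => (memLp_shifted hg T k).const_mul _

theorem toLp_signal {g : ℝ → ℂ} (hg : MemLp g 2) (T : ℝ) (n : ℕ) (X : Idx n → ℝ) :
    (memLp_signal hg T n X).toLp (signal g T n X) =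
      ∑ k, precode g T n X k • (memLp_shifted hg T k).toLp (shifted g T k) := by
  refine Lp.ext ?_
  have h1 : ∀ᵐ t, ∀ k : Idx n, ((memLp_shifted hg T k).toLp (shifted g T k) : ℝ → ℂ) t =
      shifted g T k t := ae_all_iff.2 fun k => (memLp_shifted hg T k).coeFn_toLp
  have h2 : ∀ᵐ t, ∀ k : Idx n, ((precode g T n X k • (memLp_shifted hg T k).toLp (shifted g T k) :
      Lp ℂ 2 (volume : Measure ℝ)) : ℝ → ℂ) t = precode g T n X k *
        ((memLp_shifted hg T k).toLp (shifted g T k) : ℝ → ℂ) t :=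
    ae_all_iff.2 fun k => Lp.coeFn_smul _ _
  filter_upwards [(memLp_signal hg T n X).coeFn_toLp, h1, h2, Lp.coeFn_finsetSum Finset.univ
    (fun k : Idx n => precode g T n X k • (memLp_shifted hg T k).toLp (shifted g T k))]
    with t h3 h4 h5 h6
  rw [h3, h6]
  simp [signal, h4, h5]

theorem signal_eq_sum_effectivePulse (g : ℝ → ℂ) (T : ℝ) (n : ℕ) (X : Idx n → ℝ) (t : ℝ) :
    signal g T n X t = ∑ l : Idx n, (X l : ℂ) * effectivePulse g T n l t := by
  unfold effectivePulse signal precode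
  simp only [Matrix.mulVec, dotProduct, Finset.sum_mul, Finset.mul_sum]
  rw [Finset.sum_comm]
  refine Finset.sum_congr rfl fun l _ => Finset.sum_congr rfl fun k _ => ?_
  rw [Finset.sum_eq_single l]
  · simp; ring
  · intro j _ hj
    have : (j : ℤ) ≠ l := fun h => hj (Subtype.ext h)
    simp [this]
  · simp

variable {Γ : ℝ → ℂ} {W T : ℝ} {g : ℝ → ℂ}

theorem fourier_shifted_eq (h : IsBandSpectrum Γ W) (hT : 0 < T) (hg : MemLp g 2)
    (hΓ : Γ =ᵐ[volume] (𝓕 (hg.toLp g) : Lp ℂ 2 (volume : Measure ℝ))) (k : ℤ) :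
    (𝓕 ((memLp_shifted hg T k).toLp (shifted g T k)) : Lp ℂ 2 (volume : Measure ℝ)) =
      amplitudeOp h T (basisVec h T k) := by
  refine Lp.ext ?_
  filter_upwards [fourier_shifted_ae_eq hg T k, hΓ, amplitudeOp_basisVec_ae_eq h hT k]
    with ξ h1 h2 h3
  rw [h1, h3, h2]

/-- The Gram matrix of the pulses has the entry `⟨h_k, h_l⟩` linear in `h_k` at `(k, l)`, hence is
the transpose of the abstract Gram matrix of the spectra. As `|Γ|` is even, the two agree. -/
theorem gram_eq (h : IsBandSpectrum Γ W) (hT : 0 < T) (hg : MemLp g 2)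
    (hΓ : Γ =ᵐ[volume] (𝓕 (hg.toLp g) : Lp ℂ 2 (volume : Measure ℝ)))
    (heven : ∀ᵐ ξ : ℝ, ‖Γ (-ξ)‖ = ‖Γ ξ‖) (n : ℕ) :
    gram g T n = Matrix.gram ℂ fun k : Idx n => amplitudeOp h T (basisVec h T k) := by
  ext k l
  rw [Matrix.gram_apply, inner_amplitudeOp_basisVec_comm h hT heven,
    ← fourier_shifted_eq h hT hg hΓ, ← fourier_shifted_eq h hT hg hΓ, Lp.inner_fourier_eq,
    inner_eq_integral (memLp_shifted hg T l).coeFn_toLp (memLp_shifted hg T k).coeFn_toLp]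
  simp only [gram, Matrix.of_apply]
  congr 1
  ext t
  exact mul_comm _ _

theorem linearIndependent_amplitudeOp_basisVec (h : IsBandSpectrum Γ W) (hT : T = 1 / (2 * W)) :
    LinearIndependent ℂ fun k => amplitudeOp h T (basisVec h T k) := by
  have hon := orthonormal_basisVec h hT
  rw [linearIndependent_iff']
  intro s a ha k hk
  have h1 : amplitudeOp h T (∑ k ∈ s, a k • basisVec h T k) = 0 := by
    simpa using ha
  have h2 := (amplitudeOp_eq_zero_iff_inner h hT _).1 h1 k
  rwa [hon.inner_right_sum a hk] at h2

theorem gram_posDef (h : IsBandSpectrum Γ W) (hT : T = 1 / (2 * W)) (hg : MemLp g 2)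
    (hΓ : Γ =ᵐ[volume] (𝓕 (hg.toLp g) : Lp ℂ 2 (volume : Measure ℝ)))
    (heven : ∀ᵐ ξ : ℝ, ‖Γ (-ξ)‖ = ‖Γ ξ‖) (n : ℕ) : (gram g T n).PosDef := by
  have hT0 : 0 < T := by rw [hT]; have := h.pos; positivity
  rw [gram_eq h hT0 hg hΓ heven]
  exact Matrix.posDef_gram_of_linearIndependent
    ((linearIndependent_amplitudeOp_basisVec h hT).comp _ Subtype.val_injective)

theorem posSemidef_sqrt (A : Matrix (Idx n) (Idx n) ℂ) : (CFC.sqrt A).PosSemidef :=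
  Matrix.nonneg_iff_posSemidef.1 (CFC.sqrt_nonneg A)

theorem sqrt_mul_sqrt_gram (h : IsBandSpectrum Γ W) (hT : T = 1 / (2 * W)) (hg : MemLp g 2)
    (hΓ : Γ =ᵐ[volume] (𝓕 (hg.toLp g) : Lp ℂ 2 (volume : Measure ℝ)))
    (heven : ∀ᵐ ξ : ℝ, ‖Γ (-ξ)‖ = ‖Γ ξ‖) (n : ℕ) :
    CFC.sqrt (gram g T n) * CFC.sqrt (gram g T n) = gram g T n :=
  CFC.sqrt_mul_sqrt_self _
    (Matrix.nonneg_iff_posSemidef.2 (gram_posDef h hT hg hΓ heven n).posSemidef)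

theorem isUnit_det_sqrt_gram (h : IsBandSpectrum Γ W) (hT : T = 1 / (2 * W)) (hg : MemLp g 2)
    (hΓ : Γ =ᵐ[volume] (𝓕 (hg.toLp g) : Lp ℂ 2 (volume : Measure ℝ)))
    (heven : ∀ᵐ ξ : ℝ, ‖Γ (-ξ)‖ = ‖Γ ξ‖) (n : ℕ) : IsUnit (CFC.sqrt (gram g T n)).det := by
  have h1 := (gram_posDef h hT hg hΓ heven n).isUnit
  rw [Matrix.isUnit_iff_isUnit_det, ← sqrt_mul_sqrt_gram h hT hg hΓ heven n, Matrix.det_mul] at h1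
  exact isUnit_of_mul_isUnit_left h1

theorem fourier_toLp_signal (h : IsBandSpectrum Γ W) (hT : 0 < T) (hg : MemLp g 2)
    (hΓ : Γ =ᵐ[volume] (𝓕 (hg.toLp g) : Lp ℂ 2 (volume : Measure ℝ))) (n : ℕ) (X : Idx n → ℝ) :
    (𝓕 ((memLp_signal hg T n X).toLp (signal g T n X)) : Lp ℂ 2 (volume : Measure ℝ)) =
      ∑ k, precode g T n X k • amplitudeOp h T (basisVec h T k) := by
  rw [toLp_signal hg]
  have := map_sum (Lp.fourierTransformₗᵢ ℝ ℂ)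
    (fun k : Idx n => precode g T n X k • (memLp_shifted hg T k).toLp (shifted g T k)) Finset.univ
  refine this.trans (Finset.sum_congr rfl fun k _ => ?_)
  rw [map_smul]
  congr 1
  exact fourier_shifted_eq h hT hg hΓ k

theorem energy_signal (h : IsBandSpectrum Γ W) (hT : T = 1 / (2 * W)) (hg : MemLp g 2)
    (hΓ : Γ =ᵐ[volume] (𝓕 (hg.toLp g) : Lp ℂ 2 (volume : Measure ℝ)))
    (heven : ∀ᵐ ξ : ℝ, ‖Γ (-ξ)‖ = ‖Γ ξ‖) (n : ℕ) (X : Idx n → ℝ) :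
    energy (signal g T n X) = ∑ l, X l ^ 2 := by
  have hT0 : 0 < T := by rw [hT]; have := h.pos; positivity
  have hSS := sqrt_mul_sqrt_gram h hT hg hΓ heven n
  conv_rhs at hSS => rw [gram_eq h hT0 hg hΓ heven]
  rw [energy_eq_norm_sq (memLp_signal hg T n X), ← Lp.norm_fourier_eq,
    fourier_toLp_signal h hT0 hg hΓ]
  unfold precode
  rw [norm_sum_inv_sqrt_gram _ (posSemidef_sqrt (gram g T n)).isHermitian hSS
    (isUnit_det_sqrt_gram h hT hg hΓ heven n), EuclideanSpace.norm_sq_eq]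
  simp

/-- If `|Γ| ≥ c` on the band, the precoded symbols are bounded by the data. -/
theorem sum_norm_sq_precode_le (h : IsBandSpectrum Γ W) (hT : T = 1 / (2 * W)) (hg : MemLp g 2)
    (hΓ : Γ =ᵐ[volume] (𝓕 (hg.toLp g) : Lp ℂ 2 (volume : Measure ℝ)))
    (heven : ∀ᵐ ξ : ℝ, ‖Γ (-ξ)‖ = ‖Γ ξ‖) {c : ℝ} (hc0 : 0 < c)
    (hc : ∀ ξ, |ξ| ≤ W → c ≤ ‖Γ ξ‖) (n : ℕ) (X : Idx n → ℝ) :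
    ∑ k, ‖precode g T n X k‖ ^ 2 ≤ T / c ^ 2 * ∑ l, X l ^ 2 := by
  have hT0 : 0 < T := by rw [hT]; have := h.pos; positivity
  set a := precode g T n X
  set u : Lp ℂ 2 (volume : Measure ℝ) := ∑ k : Idx n, a k • basisVec h T k with hu
  have hon : Orthonormal ℂ fun k : Idx n => basisVec h T k :=
    (orthonormal_basisVec h hT).comp _ Subtype.val_injective
  have h1 : ‖u‖ ^ 2 = ∑ k, ‖a k‖ ^ 2 := by
    have := hon.inner_sum a a Finset.univ
    rw [← hu, inner_self_eq_norm_sq_to_K] at this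
    have h4 : ((‖u‖ ^ 2 : ℝ) : ℂ) = ((∑ i, ‖a i‖ ^ 2 : ℝ) : ℂ) := by
      push_cast
      simpa [Complex.conj_mul'] using this
    exact_mod_cast h4
  have h2 : ‖amplitudeOp h T u‖ ^ 2 = ∑ l, X l ^ 2 := by
    rw [← energy_signal h hT hg hΓ heven n X, energy_eq_norm_sq (memLp_signal hg T n X),
      ← Lp.norm_fourier_eq ((memLp_signal hg T n X).toLp _), fourier_toLp_signal h hT0 hg hΓ, hu]
    simp [a]
  have hu0 : ∀ᵐ ξ, ξ ∉ Set.Icc (-W) W → u ξ = 0 := by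
    have e1 : ∀ᵐ t, ∀ k : Idx n, basisVec h T k t = modulation T k t * flatSpectrum Γ T t :=
      ae_all_iff.2 fun k => basisVec_ae_eq h T k
    have e2 : ∀ᵐ t, ∀ k : Idx n, ((a k • basisVec h T k :
        Lp ℂ 2 (volume : Measure ℝ)) : ℝ → ℂ) t = a k * basisVec h T k t :=
      ae_all_iff.2 fun k => Lp.coeFn_smul _ _
    filter_upwards [e1, e2, Lp.coeFn_finsetSum Finset.univ
      (fun k : Idx n => a k • basisVec h T k)] with t h3 h4 h5 ht
    rw [hu, h5]
    simp [h4, h3, h.flatSpectrum_eq_zero T ht]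
  have h3 : ‖(c / Real.sqrt T : ℂ) • u‖ ≤ ‖amplitudeOp h T u‖ := by
    refine Lp.norm_le_norm_of_ae_le ?_
    filter_upwards [hu0, amplitudeOp_ae_eq h T u, Lp.coeFn_smul (c / Real.sqrt T : ℂ) u]
      with ξ e1 e2 e3
    rw [e2, e3, Pi.smul_apply, norm_smul, norm_mul]
    by_cases hξ : ξ ∈ Set.Icc (-W) W
    · gcongr
      rw [← Complex.ofReal_div, Complex.norm_real, Complex.norm_real, Real.norm_eq_abs,
        Real.norm_eq_abs, abs_of_nonneg (by positivity), abs_of_nonneg (by positivity)]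
      gcongr
      exact hc ξ (abs_le.2 hξ)
    · simp [e1 hξ]
  rw [norm_smul, ← Complex.ofReal_div, Complex.norm_real, Real.norm_eq_abs,
    abs_of_nonneg (by positivity)] at h3
  have h4 := pow_le_pow_left₀ (by positivity) h3 2
  rw [mul_pow, div_pow, Real.sq_sqrt hT0.le, h1, h2] at h4
  calc ∑ k, ‖a k‖ ^ 2 = T / c ^ 2 * (c ^ 2 / T * ∑ k, ‖a k‖ ^ 2) := by
        field_simp
    _ ≤ _ := by gcongr

/-- The limiting pulse: the inverse Fourier transform of the flat spectrum. -/
noncomputable def limitPulse (h : IsBandSpectrum Γ W) (T : ℝ) : ℝ → ℂ :=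
  (𝓕⁻ ((h.memLp_flatSpectrum T 2).toLp (flatSpectrum Γ T)) : Lp ℂ 2 (volume : Measure ℝ))

theorem memLp_limitPulse (h : IsBandSpectrum Γ W) (T : ℝ) : MemLp (limitPulse h T) 2 := Lp.memLp _

theorem fourier_toLp_limitPulse (h : IsBandSpectrum Γ W) (T : ℝ) :
    (𝓕 ((memLp_limitPulse h T).toLp (limitPulse h T)) : Lp ℂ 2 (volume : Measure ℝ)) =
      (h.memLp_flatSpectrum T 2).toLp (flatSpectrum Γ T) := by
  have : (memLp_limitPulse h T).toLp (limitPulse h T) =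
      𝓕⁻ ((h.memLp_flatSpectrum T 2).toLp (flatSpectrum Γ T)) := Lp.toLp_coeFn _ _
  rw [this, FourierTransform.fourier_fourierInv_eq]

theorem fourier_toLp_shifted_limitPulse (h : IsBandSpectrum Γ W) (T : ℝ) (l : ℤ) :
    (𝓕 ((memLp_shifted (memLp_limitPulse h T) T l).toLp (shifted (limitPulse h T) T l)) :
      Lp ℂ 2 (volume : Measure ℝ)) = basisVec h T l := by
  refine Lp.ext ?_
  filter_upwards [fourier_shifted_ae_eq (memLp_limitPulse h T) T l, basisVec_ae_eq h T l,
    (h.memLp_flatSpectrum T 2).coeFn_toLp] with ξ h1 h2 h3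
  rw [h1, h2, fourier_toLp_limitPulse, h3]

theorem memLp_effectivePulse (hg : MemLp g 2) (T : ℝ) (n : ℕ) (l : ℤ) :
    MemLp (effectivePulse g T n l) 2 := memLp_signal hg T n _

/-- The effective pulses are close to the shifts of the limiting pulse, uniformly in the symbols
that stay away from the ends of the block. -/
theorem exists_energy_effectivePulse_sub_le (h : IsBandSpectrum Γ W) (hT : T = 1 / (2 * W))
    (hg : MemLp g 2) (hΓ : Γ =ᵐ[volume] (𝓕 (hg.toLp g) : Lp ℂ 2 (volume : Measure ℝ)))
    (heven : ∀ᵐ ξ : ℝ, ‖Γ (-ξ)‖ = ‖Γ ξ‖) {ε : ℝ} (hε : 0 < ε) :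
    ∃ m : ℕ, ∀ (n : ℕ) (l : ℤ), |l| + m ≤ n →
      energy (fun t => effectivePulse g T n l t - shifted (limitPulse h T) T l t) ≤ ε := by
  have hT0 : 0 < T := by rw [hT]; have := h.pos; positivity
  obtain ⟨m, hm⟩ := exists_norm_sum_inv_sqrt_gram_sub_le (orthonormal_basisVec h hT)
    (amplitudeOp_nonneg h T) (amplitudeOp_eq_zero_iff_inner h hT)
    (inner_amplitudeOp_basisVec_shift h T) (fun k j l => by
      rw [inner_amplitudeOp_basisVec h hT0, inner_amplitudeOp_basisVec h hT0,
        sub_sub_sub_cancel_right]) hε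
  refine ⟨m, fun n l hl => ?_⟩
  have hl' : l ∈ Finset.Icc (-(n : ℤ)) n := by
    rw [Finset.mem_Icc, ← abs_le]; omega
  have hSS := sqrt_mul_sqrt_gram h hT hg hΓ heven n
  conv_rhs at hSS => rw [gram_eq h hT0 hg hΓ heven]
  have h1 := hm n ⟨l, hl'⟩ hl _ (posSemidef_sqrt (gram g T n)) hSS
    (isUnit_det_sqrt_gram h hT hg hΓ heven n)
  have e1 := memLp_effectivePulse hg T n l
  have e2 := memLp_shifted (memLp_limitPulse h T) T l
  have e5 : (𝓕 (e1.toLp _ - e2.toLp _) : Lp ℂ 2 (volume : Measure ℝ)) =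
      𝓕 (e1.toLp _) - 𝓕 (e2.toLp _) := map_sub (Lp.fourierTransformₗᵢ ℝ ℂ) _ _
  have e4 : energy (fun t => effectivePulse g T n l t - shifted (limitPulse h T) T l t) =
      ‖(e1.sub e2).toLp _‖ ^ 2 := energy_eq_norm_sq (e1.sub e2)
  rw [e4, MemLp.toLp_sub e1 e2, ← Lp.norm_fourier_eq, e5, fourier_toLp_shifted_limitPulse]
  have e6 : (𝓕 (e1.toLp (effectivePulse g T n l)) : Lp ℂ 2 (volume : Measure ℝ)) = _ :=
    fourier_toLp_signal h hT0 hg hΓ n _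
  rw [e6]
  have e7 : (fun k : Idx n => (((if (k : ℤ) = l then 1 else 0 : ℝ)) : ℂ)) =
      Pi.single (⟨l, hl'⟩ : Idx n) 1 := by
    ext k
    by_cases hk : (k : ℤ) = l
    · have : k = ⟨l, hl'⟩ := Subtype.ext hk
      simp [this]
    · have : k ≠ ⟨l, hl'⟩ := fun h => hk (congrArg Subtype.val h)
      simp [hk, this]
  unfold precode
  rw [e7]
  exact h1

end Signals

/-! ### Piecewise smooth spectra and decay of the pulse -/

section Piecewise

theorem exists_bound_of_piecewise_continuous {E : Type*} [NormedAddCommGroup E] {φ : ℝ → E}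
    (S : Finset ℝ) (hS : ∀ x ∉ S, ContinuousAt φ x)
    (hl : ∀ x ∈ S, ∃ a, Tendsto φ (𝓝[<] x) (𝓝 a)) (hr : ∀ x ∈ S, ∃ a, Tendsto φ (𝓝[>] x) (𝓝 a))
    {B : ℝ} (hB : ∀ x, B < |x| → φ x = 0) : ∃ C, ∀ x, ‖φ x‖ ≤ C := by
  have hev : ∀ (l : Filter ℝ) (a : E), Tendsto φ l (𝓝 a) → ∀ᶠ y in l, ‖φ y‖ ≤ ‖a‖ + 1 :=
    fun l a h => (h.norm.eventually (gt_mem_nhds (lt_add_one ‖a‖))).mono fun y hy => hy.le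
  have hloc : ∀ x, ∃ C, ∀ᶠ y in 𝓝 x, ‖φ y‖ ≤ C := by
    intro x
    by_cases hx : x ∈ S
    · obtain ⟨a, ha⟩ := hl x hx
      obtain ⟨b, hb⟩ := hr x hx
      refine ⟨max (‖φ x‖) (max (‖a‖ + 1) (‖b‖ + 1)), ?_⟩
      have hne : ∀ᶠ y in 𝓝[≠] x, ‖φ y‖ ≤ max (‖a‖ + 1) (‖b‖ + 1) := by
        rw [← nhdsLT_sup_nhdsGT, eventually_sup]
        exact ⟨(hev _ _ ha).mono fun y hy => hy.trans (le_max_left _ _),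
          (hev _ _ hb).mono fun y hy => hy.trans (le_max_right _ _)⟩
      filter_upwards [eventually_nhdsWithin_iff.1 hne] with y hy
      by_cases hyx : y = x
      · rw [hyx]; exact le_max_left _ _
      · exact (hy hyx).trans (le_max_right _ _)
    · exact ⟨_, hev _ _ (hS x hx)⟩
  obtain ⟨C, hC⟩ : ∃ C, ∀ x ∈ Set.Icc (-B) B, ‖φ x‖ ≤ C := by
    refine isCompact_Icc.induction_on (p := fun s => ∃ C, ∀ x ∈ s, ‖φ x‖ ≤ C) ⟨0, by simp⟩
      (fun s t hst ⟨C, hC⟩ => ⟨C, fun x hx => hC x (hst hx)⟩) ?_ ?_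
    · rintro s t ⟨C, hC⟩ ⟨D, hD⟩
      exact ⟨max C D, fun x hx => hx.elim (fun h => (hC x h).trans (le_max_left _ _))
        fun h => (hD x h).trans (le_max_right _ _)⟩
    · intro x _
      obtain ⟨C, hC⟩ := hloc x
      exact ⟨_, mem_nhdsWithin_of_mem_nhds hC, C, fun y hy => hy⟩
  refine ⟨max C 0, fun x => ?_⟩
  by_cases hx : x ∈ Set.Icc (-B) B
  · exact (hC x hx).trans (le_max_left _ _)
  · rw [hB x (by by_contra h; exact hx (abs_le.1 (not_lt.1 h))), norm_zero]
    exact le_max_right _ _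

theorem PiecewiseC1.exists_bound {E : Type*} [NormedAddCommGroup E] [NormedSpace ℝ E] {f : ℝ → E}
    (hf : PiecewiseC1 f) {B : ℝ} (hB : ∀ x, B < |x| → f x = 0) : ∃ C, ∀ x, ‖f x‖ ≤ C := by
  obtain ⟨S, h1, h2⟩ := hf
  exact exists_bound_of_piecewise_continuous S (fun x hx => (h1 x hx).continuousAt)
    (fun x hx => (h2 x hx).1) (fun x hx => (h2 x hx).2.1) hB

/-- A compactly supported piecewise `C¹` function is uniformly Lipschitz on the intervals free of
break points. -/
theorem PiecewiseC1.exists_lipschitz {E : Type*} [NormedAddCommGroup E] [NormedSpace ℝ E]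
    {f : ℝ → E} (hf : PiecewiseC1 f) {B : ℝ} (hB : ∀ x, B < |x| → f x = 0) :
    ∃ (S : Finset ℝ) (L : ℝ), 0 ≤ L ∧
      ∀ x y, (∀ s ∈ S, s ∉ Set.uIcc x y) → ‖f y - f x‖ ≤ L * |y - x| := by
  obtain ⟨S, h1, h2⟩ := hf
  obtain ⟨L, hL⟩ := exists_bound_of_piecewise_continuous (φ := deriv f) S
    (fun x hx => by
      have h3 : ContinuousAt (fun y => fderiv ℝ f y 1) x :=
        ((h1 x hx).fderiv_right (m := 0) (by simp)).continuousAt.clm_apply continuousAt_const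
      simpa only [fderiv_apply_one_eq_deriv] using h3)
    (fun x hx => (h2 x hx).2.2.1) (fun x hx => (h2 x hx).2.2.2) (B := B) fun x hx => by
      have : f =ᶠ[𝓝 x] fun _ => 0 := by
        filter_upwards [(isOpen_lt continuous_const continuous_abs).mem_nhds hx] with y hy
        exact hB y hy
      rw [this.deriv_eq, deriv_const]
  refine ⟨S, L, (norm_nonneg _).trans (hL 0), fun x y hxy => ?_⟩
  exact (convex_uIcc x y).norm_image_sub_le_of_norm_deriv_le
    (fun z hz => (h1 z fun hs => hxy z hs hz).differentiableAt (by simp)) (fun z _ => hL z)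
    Set.left_mem_uIcc Set.right_mem_uIcc

/-- The Fourier transform of a bounded compactly supported function that is Lipschitz between
finitely many break points is `O(1/|w|)`: the function moves by `O(|h|)` in `L¹` under a shift by
`h`, and a shift by half a period changes the sign of the Fourier kernel. -/
theorem exists_norm_fourier_le {f : ℝ → ℂ} (hf : Integrable f) {B C L : ℝ}
    (hB0 : 0 ≤ B) (hL : 0 ≤ L)
    (hB : ∀ x, B < |x| → f x = 0) (hC : ∀ x, ‖f x‖ ≤ C) (S : Finset ℝ)
    (hS : ∀ x y, (∀ s ∈ S, s ∉ Set.uIcc x y) → ‖f y - f x‖ ≤ L * |y - x|) :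
    ∃ D, 0 ≤ D ∧ ∀ w, 1 ≤ |w| → ‖𝓕 f w‖ ≤ D / |w| := by
  have hC0 : 0 ≤ C := (norm_nonneg _).trans (hC 0)
  refine ⟨(L * (2 * (B + 1)) + ∑ s ∈ S, 2 * C * 2) / 4, by positivity, fun w hw => ?_⟩
  have hw0 : w ≠ 0 := by rintro rfl; simp at hw; linarith
  set η : ℝ := (1 / (2 * ‖w‖ ^ 2)) • w with hη
  have hηa : |η| = 1 / (2 * |w|) := by
    rw [hη, smul_eq_mul, abs_mul, Real.norm_eq_abs, abs_of_pos (by positivity)]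
    field_simp
  have hη1 : |η| ≤ 1 := by
    rw [hηa, div_le_one (by positivity)]; linarith
  have h1 : 𝓕 f w = (1 / 2 : ℝ) • ∫ v, Real.fourierChar (-inner ℝ v w) • (f v - f (v + η)) := by
    rw [Real.fourier_eq]
    have := fourierIntegral_eq_half_sub_half_period_translate hw0 hf
    rw [this, hη]
    norm_num
  have hbd : ∀ v, ‖Real.fourierChar (-inner ℝ v w) • (f v - f (v + η))‖ ≤
      (Set.Icc (-(B + 1)) (B + 1)).indicator (fun _ => L * |η|) v +
      ∑ s ∈ S, (Set.Icc (s - |η|) (s + |η|)).indicator (fun _ => 2 * C) v := by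
    intro v
    rw [Circle.norm_smul]
    have hp1 : 0 ≤ (Set.Icc (-(B + 1)) (B + 1)).indicator (fun _ => L * |η|) v :=
      Set.indicator_nonneg (fun _ _ => by positivity) _
    have hp2 : ∀ s ∈ S, 0 ≤ (Set.Icc (s - |η|) (s + |η|)).indicator (fun _ => 2 * C) v :=
      fun s _ => Set.indicator_nonneg (fun _ _ => by positivity) _
    by_cases hv : v ∈ Set.Icc (-(B + 1)) (B + 1)
    · by_cases hs : ∃ s ∈ S, s ∈ Set.uIcc v (v + η)
      · obtain ⟨s, hsS, hs⟩ := hs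
        have hmem : v ∈ Set.Icc (s - |η|) (s + |η|) := by
          have := Set.abs_sub_left_of_mem_uIcc hs
          rw [add_sub_cancel_left] at this
          have := abs_le.1 this
          constructor <;> linarith
        have h3 := Finset.single_le_sum hp2 hsS
        rw [Set.indicator_of_mem hmem] at h3
        have h4 := norm_sub_le (f v) (f (v + η))
        linarith [hC v, hC (v + η)]
      · push Not at hs
        have := hS v (v + η) hs
        rw [add_sub_cancel_left, norm_sub_rev] at this
        rw [Set.indicator_of_mem hv]
        linarith [Finset.sum_nonneg hp2]
    · have hv' : B + 1 < |v| := by by_contra h; exact hv (abs_le.1 (not_lt.1 h))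
      have h5 : |v| - |η| ≤ |v + η| := by
        have := abs_sub_abs_le_abs_sub v (-η)
        rwa [abs_neg, sub_neg_eq_add] at this
      rw [hB v (by linarith), hB (v + η) (by linarith), sub_zero, norm_zero]
      exact add_nonneg hp1 (Finset.sum_nonneg hp2)
  have hi : ∀ a b c : ℝ, Integrable ((Set.Icc a b).indicator fun _ : ℝ => c) := fun a b c =>
    (integrable_indicator_iff measurableSet_Icc).2 (integrableOn_const (by simp))
  have hint : ∀ a b c : ℝ, a ≤ b →
      ∫ v, (Set.Icc a b).indicator (fun _ : ℝ => c) v = (b - a) * c := by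
    intro a b c hab
    rw [integral_indicator measurableSet_Icc, setIntegral_const]
    simp [hab]
  have h2 := norm_integral_le_of_norm_le
    ((hi (-(B + 1)) (B + 1) (L * |η|)).add (integrable_finsetSum S fun s _ =>
      hi (s - |η|) (s + |η|) (2 * C))) (ae_of_all _ hbd)
  simp only [Pi.add_apply] at h2
  rw [integral_add (hi _ _ _) (integrable_finsetSum S fun s _ => hi _ _ _),
    integral_finsetSum S fun s _ => hi _ _ _, hint _ _ _ (by linarith)] at h2
  have h6 : ∀ s ∈ S, ∫ v, (Set.Icc (s - |η|) (s + |η|)).indicator (fun _ => 2 * C) v =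
      2 * C * 2 * |η| := fun s _ => by
    rw [hint _ _ _ (by linarith [abs_nonneg η])]; ring
  rw [Finset.sum_congr rfl h6, ← Finset.sum_mul] at h2
  rw [h1, norm_smul]
  calc _ ≤ ‖(1 / 2 : ℝ)‖ * _ := mul_le_mul_of_nonneg_left h2 (norm_nonneg _)
    _ = _ := by
      rw [hηa, Real.norm_of_nonneg (by norm_num)]
      field_simp
      ring

variable {Γ : ℝ → ℂ} {W T : ℝ} {g : ℝ → ℂ}

theorem ae_eq_fourierInv (h : IsBandSpectrum Γ W) (hg : MemLp g 2)
    (hΓ : Γ =ᵐ[volume] (𝓕 (hg.toLp g) : Lp ℂ 2 (volume : Measure ℝ))) : g =ᵐ[volume] 𝓕⁻ Γ := by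
  have h1 : (𝓕 (hg.toLp g) : Lp ℂ 2 (volume : Measure ℝ)) = (h.memLp 2).toLp Γ := by
    refine Lp.ext ?_
    filter_upwards [hΓ, (h.memLp 2).coeFn_toLp] with ξ h1 h2
    rw [← h1, h2]
  have h2 : hg.toLp g = 𝓕⁻ ((h.memLp 2).toLp Γ) := by
    rw [← h1, FourierTransform.fourierInv_fourier_eq]
  have h3 := fourierInv_toLp_ae_eq (memLp_one_iff_integrable.1 (h.memLp 1)) (h.memLp 2)
  rw [← h2] at h3
  exact hg.coeFn_toLp.symm.trans h3

/-- A pulse whose spectrum `G` is piecewise `C¹` decays like `1/|t|`. -/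
theorem exists_norm_pulse_le {G : ℝ → ℂ} (hG : PiecewiseC1 G)
    (h : IsBandSpectrum (fun ξ => G (2 * Real.pi * ξ)) W) (hg : MemLp g 2)
    (hΓ : (fun ξ => G (2 * Real.pi * ξ)) =ᵐ[volume]
      (𝓕 (hg.toLp g) : Lp ℂ 2 (volume : Measure ℝ))) :
    ∃ D, 0 ≤ D ∧ ∀ᵐ t, 1 ≤ |t| → ‖g t‖ ≤ D / |t| := by
  have hpi : 0 < 2 * Real.pi := by positivity
  have hB : ∀ x, 2 * Real.pi * W < |x| → G x = 0 := by
    intro x hx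
    have := h.eq_zero (x / (2 * Real.pi)) (by
      rw [abs_div, abs_of_pos hpi, lt_div_iff₀ hpi]; linarith)
    rwa [mul_div_cancel₀ _ hpi.ne'] at this
  obtain ⟨S, L, hL, hS⟩ := hG.exists_lipschitz hB
  obtain ⟨C, hC⟩ := h.bounded
  have hint : Integrable fun ξ => G (2 * Real.pi * ξ) := memLp_one_iff_integrable.1 (h.memLp 1)
  obtain ⟨D, hD0, hD⟩ := exists_norm_fourier_le hint (B := W) (C := C) (L := L * (2 * Real.pi))
    h.pos.le (by positivity) h.eq_zero hC (S.image fun s => s / (2 * Real.pi)) (by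
      intro x y hxy
      have := hS (2 * Real.pi * x) (2 * Real.pi * y) (fun s hs hs' => by
        refine hxy (s / (2 * Real.pi)) (Finset.mem_image_of_mem _ hs) ?_
        rw [Set.mem_uIcc] at hs' ⊢
        simp only [le_div_iff₀ hpi, div_le_iff₀ hpi, mul_comm _ (2 * Real.pi)]
        exact hs')
      rw [← mul_sub, abs_mul, abs_of_pos hpi] at this
      linarith)
  refine ⟨D, hD0, ?_⟩
  filter_upwards [ae_eq_fourierInv h hg hΓ] with t ht ht1
  rw [ht, Real.fourierInv_eq_fourier_neg]
  have := hD (-t) (by rwa [abs_neg])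
  rwa [abs_neg] at this

theorem limitPulse_ae_eq (h : IsBandSpectrum Γ W) (T : ℝ) :
    limitPulse h T =ᵐ[volume] 𝓕⁻ (flatSpectrum Γ T) :=
  fourierInv_toLp_ae_eq (memLp_one_iff_integrable.1 (h.memLp_flatSpectrum T 1))
    (h.memLp_flatSpectrum T 2)

theorem limitPulse_ae_eq_sinc (h : IsBandSpectrum Γ W) (hT : T = 1 / (2 * W))
    (hpos : ∀ ξ, |ξ| ≤ W → Γ ξ = (‖Γ ξ‖ : ℂ)) :
    limitPulse h T =ᵐ[volume]
      fun t => ((1 / Real.sqrt T * Real.sinc (Real.pi * t / T) : ℝ) : ℂ) := by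
  have hW := h.pos
  have hT0 : 0 < T := by rw [hT]; positivity
  filter_upwards [limitPulse_ae_eq h T, Measure.ae_ne volume 0] with t ht ht0
  rw [ht, Real.fourierInv_eq']
  have e1 : ∀ v, Complex.exp (((2 * Real.pi * inner ℝ v t : ℝ) : ℂ) * Complex.I) •
      flatSpectrum Γ T v = (Set.Icc (-W) W).indicator (fun v : ℝ =>
        (Real.sqrt T : ℂ) * Complex.exp ((2 * Real.pi * t * Complex.I) * v)) v := by
    intro v
    by_cases hv : v ∈ Set.Icc (-W) W
    · have h1 : (‖Γ v‖ : ℂ) ≠ 0 := by simpa using h.ne_zero v (abs_le.2 hv)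
      rw [Set.indicator_of_mem hv, flatSpectrum]
      nth_rewrite 1 [hpos v (abs_le.2 hv)]
      rw [div_self h1, mul_one, smul_eq_mul, mul_comm]
      congr 2
      simp
      ring
    · rw [Set.indicator_of_notMem hv, h.flatSpectrum_eq_zero T hv, smul_zero]
  simp_rw [e1]
  have hc : (2 * Real.pi * t * Complex.I : ℂ) ≠ 0 := by
    simp [Real.pi_ne_zero, ht0]
  rw [integral_indicator measurableSet_Icc, integral_const_mul, integral_Icc_eq_integral_Ioc,
    ← intervalIntegral.integral_of_le (by linarith), integral_exp_mul_complex hc]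
  have hx : Real.pi * t / T ≠ 0 := by
    have := Real.pi_ne_zero
    positivity
  rw [Real.sinc_of_ne_zero hx]
  have hxe : Real.pi * t / T = 2 * Real.pi * t * W := by rw [hT]; field_simp
  have h3 : Complex.exp (2 * Real.pi * t * Complex.I * W) -
      Complex.exp (2 * Real.pi * t * Complex.I * (-W : ℝ)) =
      2 * Complex.I * Complex.sin ((2 * Real.pi * t * W : ℝ) : ℂ) := by
    rw [Complex.sin]
    push_cast
    have e2 : (2 * Real.pi * t * Complex.I * W : ℂ) = 2 * Real.pi * t * W * Complex.I := by ring
    have e3 : (2 * Real.pi * t * Complex.I * -W : ℂ) = -(2 * Real.pi * t * W) * Complex.I := by ring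
    rw [e2, e3]
    field_simp
    ring_nf
    simp [Complex.I_sq]
    ring
  rw [h3, hxe, ← Complex.ofReal_sin]
  have hs : (Real.sqrt T : ℂ) ≠ 0 := by exact_mod_cast (Real.sqrt_pos.2 hT0).ne'
  have hs2 : (Real.sqrt T : ℂ) * Real.sqrt T = 1 / (2 * W) := by
    rw [← Complex.ofReal_mul, Real.mul_self_sqrt hT0.le, hT]; push_cast; rfl
  have hWc : (W : ℂ) ≠ 0 := by exact_mod_cast hW.ne'
  have htc : (t : ℂ) ≠ 0 := by exact_mod_cast ht0
  have hpc : (Real.pi : ℂ) ≠ 0 := by exact_mod_cast Real.pi_ne_zero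
  generalize Real.sin (2 * Real.pi * t * W) = σ
  push_cast
  have hs3 : (Real.sqrt T : ℂ) = (1 / Real.sqrt T) * (1 / (2 * W)) := by
    rw [← hs2]; field_simp
  conv_lhs => rw [hs3]
  field_simp

end Piecewise

/-! ### Localization of the effective pulses and of signals of finite energy -/

section Localization

theorem measurableSet_window (T : ℝ) (n : ℕ) : MeasurableSet (window T n) := measurableSet_Icc

theorem integrable_norm_sq {f : ℝ → ℂ} (hf : MemLp f 2) : Integrable fun t => ‖f t‖ ^ 2 :=
  hf.norm.integrable_sq

theorem energyIn_nonneg (f : ℝ → ℂ) (Ω : Set ℝ) : 0 ≤ energyIn f Ω :=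
  integral_nonneg fun _ => by positivity

theorem energy_nonneg (f : ℝ → ℂ) : 0 ≤ energy f := integral_nonneg fun _ => by positivity

theorem energyIn_le_energy {f : ℝ → ℂ} (hf : MemLp f 2) (Ω : Set ℝ) : energyIn f Ω ≤ energy f :=
  setIntegral_le_integral (integrable_norm_sq hf) (ae_of_all _ fun _ => by positivity)

theorem energyIn_add_compl {f : ℝ → ℂ} (hf : MemLp f 2) {Ω : Set ℝ} (hΩ : MeasurableSet Ω) :
    energyIn f Ω + energyIn f Ωᶜ = energy f :=
  integral_add_compl hΩ (integrable_norm_sq hf)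

theorem concentration_eq {f : ℝ → ℂ} (hf : MemLp f 2) {Ω : Set ℝ} (hΩ : MeasurableSet Ω)
    (h0 : energy f ≠ 0) : concentration f Ω = 1 - energyIn f Ωᶜ / energy f := by
  rw [concentration, ← energyIn_add_compl hf hΩ] at *
  field_simp
  ring

theorem norm_add_sq_le (a b : ℂ) : ‖a + b‖ ^ 2 ≤ 2 * ‖a‖ ^ 2 + 2 * ‖b‖ ^ 2 := by
  have h := pow_le_pow_left₀ (norm_nonneg _) (norm_add_le a b) 2
  nlinarith [sq_nonneg (‖a‖ - ‖b‖)]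

theorem energyIn_add_le {f h : ℝ → ℂ} (hf : MemLp f 2) (hh : MemLp h 2) (Ω : Set ℝ) :
    energyIn (fun t => f t + h t) Ω ≤ 2 * energyIn f Ω + 2 * energyIn h Ω := by
  unfold energyIn
  rw [← integral_const_mul, ← integral_const_mul, ← integral_add
    ((integrable_norm_sq hf).integrableOn.const_mul 2)
    ((integrable_norm_sq hh).integrableOn.const_mul 2)]
  exact integral_mono (integrable_norm_sq (hf.add hh)).integrableOn
    (((integrable_norm_sq hf).integrableOn.const_mul 2).add
      ((integrable_norm_sq hh).integrableOn.const_mul 2)) fun t => norm_add_sq_le _ _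

theorem energyIn_univ (f : ℝ → ℂ) : energyIn f Set.univ = energy f := by
  simp [energyIn, energy]

theorem energy_shifted (s : ℝ → ℂ) (T : ℝ) (l : ℤ) : energy (shifted s T l) = energy s :=
  integral_sub_right_eq_self (fun t => ‖s t‖ ^ 2) (l * T)

/-- The tails of the shifts of one square integrable pulse outside the window are small, uniformly
in the shifts that stay away from the ends of the window. -/
theorem exists_energyIn_shifted_compl_le {s : ℝ → ℂ} (hs : MemLp s 2) {T : ℝ} (hT : 0 < T) {ε : ℝ}
    (hε : 0 < ε) : ∃ m : ℕ, ∀ (n : ℕ) (l : ℤ), |l| + m ≤ n →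
      energyIn (shifted s T l) (window T n)ᶜ ≤ ε := by
  have hanti : Antitone fun m : ℕ => (window T m)ᶜ := by
    intro m n hmn
    refine Set.compl_subset_compl.2 (Set.Icc_subset_Icc ?_ ?_) <;>
    · have : (m : ℝ) * T ≤ n * T := by gcongr
      linarith
  have hempty : ⋂ m : ℕ, (window T m)ᶜ = ∅ := by
    rw [← Set.compl_iUnion, Set.compl_empty_iff, Set.eq_univ_iff_forall]
    intro t
    obtain ⟨m, hm⟩ := exists_nat_ge (|t| / T)
    rw [div_le_iff₀ hT] at hm
    exact Set.mem_iUnion.2 ⟨m, abs_le.1 hm⟩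
  have ht := hanti.tendsto_setIntegral (fun m => (measurableSet_window T m).compl)
    (integrable_norm_sq hs).integrableOn
  rw [hempty, setIntegral_empty] at ht
  obtain ⟨m, hm⟩ := (ht.eventually (gt_mem_nhds hε)).exists
  refine ⟨m, fun n l hl => le_trans ?_ hm.le⟩
  have h1 : energyIn (shifted s T l) (window T n)ᶜ =
      ∫ t, (fun u => (window T n)ᶜ.indicator (fun _ => ‖s u‖ ^ 2) (u + l * T)) (t - l * T) := by
    unfold energyIn
    rw [← integral_indicator (measurableSet_window T n).compl]
    congr 1
    ext t
    change _ = (window T n)ᶜ.indicator (fun _ => ‖s (t - l * T)‖ ^ 2) (t - l * T + l * T)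
    rw [sub_add_cancel]
    rfl
  rw [h1.trans (integral_sub_right_eq_self
    (fun u => (window T n)ᶜ.indicator (fun _ => ‖s u‖ ^ 2) (u + l * T)) (l * T)),
    ← integral_indicator (measurableSet_window T m).compl]
  have hsub : ∀ u, u + l * T ∈ (window T n)ᶜ → u ∈ (window T m)ᶜ := by
    intro u hu hu'
    refine hu ?_
    have h2 : (|l| : ℝ) + m ≤ n := by exact_mod_cast hl
    have h3 := le_abs_self (l : ℝ)
    have h4 := neg_abs_le (l : ℝ)
    have h5 : (l : ℝ) * T + m * T ≤ n * T := by rw [← add_mul]; gcongr; linarith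
    have h6 : -((l : ℝ) * T) + m * T ≤ n * T := by
      rw [← neg_mul, ← add_mul]; gcongr; linarith
    obtain ⟨h7, h8⟩ := hu'
    constructor <;> linarith
  have hmeas : MeasurableSet {u : ℝ | u + l * T ∈ (window T n)ᶜ} :=
    (measurable_add_const _) (measurableSet_window T n).compl
  refine integral_mono (((integrable_norm_sq hs).indicator hmeas).congr (ae_of_all _ fun u => ?_))
    ((integrable_norm_sq hs).indicator (measurableSet_window T m).compl) fun u => ?_
  · rfl
  · by_cases hu : u + l * T ∈ (window T n)ᶜ
    · rw [Set.indicator_of_mem hu, Set.indicator_of_mem (hsub u hu)]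
    · rw [Set.indicator_of_notMem hu]
      exact Set.indicator_nonneg (fun _ _ => by positivity) _

theorem card_Idx (n : ℕ) : Fintype.card (Idx n) = 2 * n + 1 := by
  rw [Fintype.card_coe, Int.card_Icc]
  omega

/-- Averages over `|l| ≤ n` of a bounded quantity that is small for `l` away from the ends
`± n` tend to zero. -/
theorem tendsto_average_of_interior {f : ℕ → ℤ → ℝ} {C : ℝ} (h0 : ∀ n l, 0 ≤ f n l)
    (hC : ∀ n (l : Idx n), f n l ≤ C)
    (hf : ∀ ε, 0 < ε → ∃ m : ℕ, ∀ (n : ℕ) (l : ℤ), |l| + m ≤ n → f n l ≤ ε) :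
    Tendsto (fun n : ℕ => (∑ l : Idx n, f n l) / (2 * n + 1)) atTop (𝓝 0) := by
  have hC0 : 0 ≤ C := (h0 0 0).trans (hC 0 ⟨0, by simp⟩)
  have hpos : ∀ n : ℕ, (0 : ℝ) < 2 * n + 1 := fun n => by positivity
  rw [Metric.tendsto_atTop]
  intro ε hε
  obtain ⟨m, hm⟩ := hf (ε / 2) (by positivity)
  obtain ⟨N, hN⟩ := exists_nat_gt (2 * m * C / (ε / 2))
  refine ⟨N, fun n hn => ?_⟩
  have hnn : 0 ≤ (∑ l : Idx n, f n l) / (2 * n + 1) :=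
    div_nonneg (Finset.sum_nonneg fun l _ => h0 n l) (hpos n).le
  rw [Real.dist_eq, sub_zero, abs_of_nonneg hnn, div_lt_iff₀ (hpos n)]
  have h1 : ∀ l : Idx n, f n l ≤ ε / 2 + if (n : ℤ) < |(l : ℤ)| + m then C else 0 := by
    intro l
    split_ifs with hl
    · linarith [hC n l]
    · linarith [hm n l (not_lt.1 hl)]
  have h2 : ∑ l : Idx n, (if (n : ℤ) < |(l : ℤ)| + m then C else 0) ≤ 2 * m * C := by
    rw [Finset.sum_coe_sort (Finset.Icc (-(n : ℤ)) n)
      (fun l => if (n : ℤ) < |l| + m then C else 0), ← Finset.sum_filter, Finset.sum_const,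
      nsmul_eq_mul]
    gcongr
    have hsub : (Finset.Icc (-(n : ℤ)) n).filter (fun l => (n : ℤ) < |l| + m) ⊆
        Finset.Icc (-(n : ℤ)) (-n + m - 1) ∪ Finset.Icc ((n : ℤ) - m + 1) n := by
      intro l
      simp only [Finset.mem_filter, Finset.mem_union, Finset.mem_Icc]
      rintro ⟨⟨h3, h4⟩, h5⟩
      rcases abs_cases l with ⟨h6, _⟩ | ⟨h6, _⟩ <;> omega
    have h3 := (Finset.card_le_card hsub).trans (Finset.card_union_le _ _)
    rw [Int.card_Icc, Int.card_Icc] at h3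
    have h4 : ((Finset.Icc (-(n : ℤ)) n).filter (fun l => (n : ℤ) < |l| + m)).card ≤ 2 * m := by
      omega
    exact_mod_cast h4
  calc ∑ l : Idx n, f n l ≤ ∑ l : Idx n, (ε / 2 + if (n : ℤ) < |(l : ℤ)| + m then C else 0) :=
        Finset.sum_le_sum fun l _ => h1 l
    _ ≤ (2 * n + 1) * (ε / 2) + 2 * m * C := by
        rw [Finset.sum_add_distrib, Finset.sum_const, Finset.card_univ, card_Idx, nsmul_eq_mul]
        push_cast
        linarith
    _ < ε * (2 * n + 1) := by
        rw [div_lt_iff₀ (by positivity)] at hN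
        have h5 : (N : ℝ) * (ε / 2) ≤ n * (ε / 2) := by gcongr
        nlinarith

/-- The two properties of a precoded system on which its time localization rests: the precoding is
isometric, and the effective pulses away from the ends of the block are close to the shifts of one
pulse `s`. -/
structure HasLimitPulse (g s : ℝ → ℂ) (T : ℝ) : Prop where
  pos : 0 < T
  memLp : MemLp g 2
  memLp_limit : MemLp s 2
  energy_signal : ∀ n (X : Idx n → ℝ), energy (signal g T n X) = ∑ l, X l ^ 2
  exists_energy_sub_le : ∀ ε, 0 < ε → ∃ m : ℕ, ∀ (n : ℕ) (l : ℤ), |l| + m ≤ n →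
    energy (fun t => effectivePulse g T n l t - shifted s T l t) ≤ ε

variable {g s : ℝ → ℂ} {T : ℝ}

namespace HasLimitPulse

theorem energy_effectivePulse (h : HasLimitPulse g s T) (n : ℕ) (l : Idx n) :
    energy (effectivePulse g T n l) = 1 := by
  unfold effectivePulse
  rw [h.energy_signal, Finset.sum_eq_single l] <;>
    simp +contextual

theorem tendsto_energy_sub (h : HasLimitPulse g s T) (l : ℤ) :
    Tendsto (fun n => energy fun t => effectivePulse g T n l t - shifted s T l t) atTop (𝓝 0) := by
  rw [Metric.tendsto_atTop]
  intro ε hε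
  obtain ⟨m, hm⟩ := h.exists_energy_sub_le (ε / 2) (by positivity)
  refine ⟨l.natAbs + m, fun n hn => ?_⟩
  have h1 := hm n l (by rw [Int.abs_eq_natAbs]; exact_mod_cast hn)
  rw [Real.dist_eq, sub_zero, abs_of_nonneg (energy_nonneg _)]
  linarith

theorem tendsto_average_energy_sub (h : HasLimitPulse g s T) :
    Tendsto (fun n : ℕ => (∑ l : Idx n, energy fun t =>
      effectivePulse g T n l t - shifted s T l t) / (2 * n + 1)) atTop (𝓝 0) := by
  refine tendsto_average_of_interior (f := fun n l => energy fun t =>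
    effectivePulse g T n l t - shifted s T l t) (C := 2 * 1 + 2 * energy s)
    (fun n l => energy_nonneg _) (fun n l => ?_) h.exists_energy_sub_le
  have h1 := energyIn_add_le (memLp_effectivePulse h.memLp T n l)
    (memLp_shifted h.memLp_limit T l).neg Set.univ
  simp only [energyIn_univ, h.energy_effectivePulse] at h1
  have h2 : energy (-shifted s T l) = energy s := by
    rw [← energy_shifted s T l]; simp [energy]
  rw [h2] at h1
  simpa [sub_eq_add_neg] using h1

/-- The effective pulses away from the ends of the block are localized in the window. -/
theorem exists_energyIn_compl_le (h : HasLimitPulse g s T) {ε : ℝ} (hε : 0 < ε) :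
    ∃ m : ℕ, ∀ (n : ℕ) (l : ℤ), |l| + m ≤ n →
      energyIn (effectivePulse g T n l) (window T n)ᶜ ≤ ε := by
  obtain ⟨m₁, hm₁⟩ := h.exists_energy_sub_le (ε / 4) (by positivity)
  obtain ⟨m₂, hm₂⟩ := exists_energyIn_shifted_compl_le h.memLp_limit h.pos (ε := ε / 4)
    (by positivity)
  refine ⟨max m₁ m₂, fun n l hl => ?_⟩
  push_cast at hl
  have h1 := hm₁ n l (by have := le_max_left (m₁ : ℤ) m₂; linarith)
  have h2 := hm₂ n l (by have := le_max_right (m₁ : ℤ) m₂; linarith)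
  have hd := (memLp_effectivePulse h.memLp T n l).sub (memLp_shifted h.memLp_limit T l)
  have h3 := energyIn_add_le hd (memLp_shifted h.memLp_limit T l) (window T n)ᶜ
  simp only [Pi.sub_apply, sub_add_cancel] at h3
  have h4 := energyIn_le_energy hd (window T n)ᶜ
  have h5 : energy (effectivePulse g T n l - shifted s T l) ≤ ε / 4 := h1
  linarith

theorem tendsto_average_energyIn_compl (h : HasLimitPulse g s T) :
    Tendsto (fun n : ℕ => (∑ l : Idx n, energyIn (effectivePulse g T n l) (window T n)ᶜ) /
      (2 * n + 1)) atTop (𝓝 0) :=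
  tendsto_average_of_interior (f := fun n l => energyIn (effectivePulse g T n l) (window T n)ᶜ)
    (fun _ _ => energyIn_nonneg _ _)
    (fun n l => (energyIn_le_energy (memLp_effectivePulse h.memLp T n l) _).trans
      (h.energy_effectivePulse n l).le) fun _ hε => h.exists_energyIn_compl_le hε

theorem tendsto_energyIn_compl (h : HasLimitPulse g s T) (l : ℤ) :
    Tendsto (fun n => energyIn (effectivePulse g T n l) (window T n)ᶜ) atTop (𝓝 0) := by
  rw [Metric.tendsto_atTop]
  intro ε hε
  obtain ⟨m, hm⟩ := h.exists_energyIn_compl_le (ε := ε / 2) (by positivity)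
  refine ⟨l.natAbs + m, fun n hn => ?_⟩
  have h1 := hm n l (by rw [Int.abs_eq_natAbs]; exact_mod_cast hn)
  rw [Real.dist_eq, sub_zero, abs_of_nonneg (energyIn_nonneg _ _)]
  linarith

theorem concentration_signal (h : HasLimitPulse g s T) (n : ℕ) (X : Idx n → ℝ)
    {Ω : Set ℝ} (hΩ : MeasurableSet Ω) (h0 : ∑ l, X l ^ 2 ≠ 0) :
    concentration (signal g T n X) Ω =
      1 - energyIn (signal g T n X) Ωᶜ / ∑ l, X l ^ 2 := by
  rw [concentration_eq (memLp_signal h.memLp T n X) hΩ (by rwa [h.energy_signal]),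
    h.energy_signal]

/-- For data of finite energy the energy outside the window tends to zero: finitely many symbols
carry almost all of the energy, and each of their effective pulses is eventually localized. -/
theorem tendsto_energyIn_signal_compl (h : HasLimitPulse g s T) {x : ℤ → ℝ}
    (hx : Summable fun k => x k ^ 2) :
    Tendsto (fun n : ℕ => energyIn (signal g T n fun k => x k) (window T n)ᶜ) atTop (𝓝 0) := by
  rw [Metric.tendsto_atTop]
  intro ε hε
  obtain ⟨F, hF⟩ := hx.vanishing (Metric.ball_mem_nhds 0 (show 0 < ε / 4 by positivity))
  have hlim : Tendsto (fun n => (∑ l ∈ F, x l ^ 2) *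
      ∑ l ∈ F, energyIn (effectivePulse g T n l) (window T n)ᶜ) atTop (𝓝 0) := by
    have := (tendsto_finsetSum F fun l _ => h.tendsto_energyIn_compl l).const_mul
      (∑ l ∈ F, x l ^ 2)
    simpa using this
  obtain ⟨N, hN⟩ := eventually_atTop.1 (hlim.eventually (gt_mem_nhds
    (show 0 < ε / 4 by positivity)))
  refine ⟨max N (F.sup Int.natAbs), fun n hn => ?_⟩
  rw [Real.dist_eq, sub_zero, abs_of_nonneg (energyIn_nonneg _ _)]
  have hFn : F ⊆ Finset.Icc (-(n : ℤ)) n := fun k hk => by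
    have h1 : k.natAbs ≤ F.sup Int.natAbs := Finset.le_sup hk
    have h2 := (le_max_right N _).trans hn
    rw [Finset.mem_Icc]
    omega
  set X1 : Idx n → ℝ := fun k => if (k : ℤ) ∈ F then x k else 0 with hX1
  set X2 : Idx n → ℝ := fun k => if (k : ℤ) ∈ F then 0 else x k with hX2
  have hsplit : (signal g T n fun k => x k) = fun t => signal g T n X1 t + signal g T n X2 t := by
    ext t
    simp only [signal_eq_sum_effectivePulse g T n _ t, ← Finset.sum_add_distrib, ← add_mul]
    refine Finset.sum_congr rfl fun k _ => ?_
    by_cases hk : (k : ℤ) ∈ F <;> simp [hX1, hX2, hk]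
  have h1 : signal g T n X1 = fun t => ∑ l ∈ F, (x l : ℂ) * effectivePulse g T n l t := by
    ext t
    rw [signal_eq_sum_effectivePulse]
    rw [Finset.sum_coe_sort (Finset.Icc (-(n : ℤ)) n)
      (fun l => ((if l ∈ F then x l else 0 : ℝ) : ℂ) * effectivePulse g T n l t)]
    rw [← Finset.sum_subset hFn fun l _ hl => by simp [hl]]
    exact Finset.sum_congr rfl fun l hl => by simp [hl]
  have h2 : energyIn (signal g T n X1) (window T n)ᶜ ≤ (∑ l ∈ F, x l ^ 2) *
      ∑ l ∈ F, energyIn (effectivePulse g T n l) (window T n)ᶜ := by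
    rw [h1]
    unfold energyIn
    have hi : ∀ l ∈ F, IntegrableOn (fun t => ‖effectivePulse g T n l t‖ ^ 2) (window T n)ᶜ :=
      fun l _ => (integrable_norm_sq (memLp_effectivePulse h.memLp T n l)).integrableOn
    rw [← integral_finsetSum F hi, ← integral_const_mul]
    have hm : MemLp (fun t => ∑ l ∈ F, (x l : ℂ) * effectivePulse g T n l t) 2 :=
      memLp_finsetSum _ fun l _ => (memLp_effectivePulse h.memLp T n l).const_mul _
    refine integral_mono (integrable_norm_sq hm).integrableOn
      ((integrable_finsetSum F hi).const_mul _) fun t => ?_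
    have hcs := Finset.sum_mul_sq_le_sq_mul_sq F (fun l => |x l|)
      fun l => ‖effectivePulse g T n l t‖
    simp only [sq_abs] at hcs
    refine le_trans (pow_le_pow_left₀ (norm_nonneg _) ((norm_sum_le _ _).trans_eq ?_) 2) hcs
    exact Finset.sum_congr rfl fun l _ => by simp
  have h3 : energyIn (signal g T n X2) (window T n)ᶜ < ε / 4 := by
    refine (energyIn_le_energy (memLp_signal h.memLp T n X2) _).trans_lt ?_
    rw [h.energy_signal, Finset.sum_coe_sort (Finset.Icc (-(n : ℤ)) n)
      (fun l => (if l ∈ F then 0 else x l) ^ 2)]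
    have h4 := hF (Finset.Icc (-(n : ℤ)) n \ F) Finset.sdiff_disjoint
    rw [mem_ball_zero_iff, Real.norm_eq_abs] at h4
    have h5 : ∑ l ∈ Finset.Icc (-(n : ℤ)) n, (if l ∈ F then 0 else x l) ^ 2 =
        ∑ l ∈ Finset.Icc (-(n : ℤ)) n \ F, x l ^ 2 := by
      rw [Finset.sdiff_eq_filter, Finset.sum_filter]
      refine Finset.sum_congr rfl fun l _ => ?_
      by_cases hl : l ∈ F <;> simp [hl]
    rw [h5]
    exact (le_abs_self _).trans_lt h4
  have h6 := energyIn_add_le (memLp_signal h.memLp T n X1) (memLp_signal h.memLp T n X2)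
    (window T n)ᶜ
  rw [← hsplit] at h6
  have h7 := hN n ((le_max_left _ _).trans hn)
  linarith

theorem tendsto_Idx_sum {f : ℤ → ℝ} (hf : Summable f) :
    Tendsto (fun n : ℕ => ∑ l : Idx n, f l) atTop (𝓝 (∑' l, f l)) := by
  have h1 : Tendsto (fun n : ℕ => Finset.Icc (-(n : ℤ)) n) atTop atTop := by
    refine tendsto_atTop_atTop.2 fun F => ⟨F.sup Int.natAbs, fun n hn k hk => ?_⟩
    have h1 : k.natAbs ≤ F.sup Int.natAbs := Finset.le_sup hk
    rw [Finset.mem_Icc]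
    omega
  refine (hf.hasSum.comp h1).congr fun n => ?_
  exact (Finset.sum_coe_sort (Finset.Icc (-(n : ℤ)) n) f).symm

theorem tendsto_concentration (h : HasLimitPulse g s T) {x : ℤ → ℝ}
    (hx : Summable fun k => x k ^ 2) (hx0 : x ≠ 0) :
    Tendsto (fun n : ℕ => concentration (signal g T n fun k => x k) (window T n)) atTop (𝓝 1) := by
  have h1 := tendsto_Idx_sum hx
  obtain ⟨k, hk⟩ := Function.ne_iff.1 hx0
  have h2 : 0 < ∑' l, x l ^ 2 := hx.tsum_pos (fun l => sq_nonneg _) k (by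
    have : x k ≠ 0 := hk
    positivity)
  have h3 := (h.tendsto_energyIn_signal_compl hx).div h1 h2.ne'
  rw [zero_div] at h3
  have h4 : Tendsto (fun n : ℕ => 1 - energyIn (signal g T n fun k => x k) (window T n)ᶜ /
      ∑ l : Idx n, x l ^ 2) atTop (𝓝 1) := by
    simpa using h3.const_sub 1
  refine h4.congr' ?_
  filter_upwards [h1.eventually (lt_mem_nhds h2)] with n hn
  exact (h.concentration_signal n _ (measurableSet_window T n) hn.ne').symm

end HasLimitPulse

end Localization

/-! ### Random data -/

section Random

variable {g s : ℝ → ℂ} {T : ℝ}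

theorem norm_sq_sum {ι : Type*} [Fintype ι] (X : ι → ℝ) (z : ι → ℂ) :
    ‖∑ k, (X k : ℂ) * z k‖ ^ 2 = ∑ k, ∑ l, X k * X l * (z k * conj (z l)).re := by
  have h1 : ((‖∑ k, (X k : ℂ) * z k‖ ^ 2 : ℝ) : ℂ) =
      ∑ k, ∑ l, ((X k * X l : ℝ) : ℂ) * (z k * conj (z l)) := by
    push_cast
    rw [← Complex.mul_conj', map_sum, Finset.sum_mul_sum]
    refine Finset.sum_congr rfl fun k _ => Finset.sum_congr rfl fun l _ => ?_
    rw [map_mul, Complex.conj_ofReal]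
    ring
  have h2 := congrArg Complex.re h1
  simpa only [Complex.ofReal_re, Complex.re_sum, Complex.re_ofReal_mul] using h2

theorem integrable_re_mul_conj {f h : ℝ → ℂ} (hf : MemLp f 2) (hh : MemLp h 2) :
    Integrable fun t => (f t * conj (h t)).re := by
  have : Integrable (fun t => f t * conj (h t)) := hf.integrable_mul hh.star
  exact this.re

/-- The energy of a signal in a set is a quadratic form in the data. -/
theorem energyIn_signal (hg : MemLp g 2) (n : ℕ) (X : Idx n → ℝ) (Ω : Set ℝ) :
    energyIn (signal g T n X) Ω = ∑ k : Idx n, ∑ l : Idx n, X k * X l *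
      ∫ t in Ω, (effectivePulse g T n k t * conj (effectivePulse g T n l t)).re := by
  unfold energyIn
  simp_rw [signal_eq_sum_effectivePulse g T n X, norm_sq_sum]
  have hi : ∀ k l : Idx n, IntegrableOn (fun t => X k * X l *
      (effectivePulse g T n k t * conj (effectivePulse g T n l t)).re) Ω := fun k l =>
    ((integrable_re_mul_conj (memLp_effectivePulse hg T n k)
      (memLp_effectivePulse hg T n l)).const_mul _).integrableOn
  rw [integral_finsetSum _ fun k _ => integrable_finsetSum _ fun l _ => hi k l]
  refine Finset.sum_congr rfl fun k _ => ?_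
  rw [integral_finsetSum _ fun l _ => hi k l]
  exact Finset.sum_congr rfl fun l _ => integral_const_mul _ _

variable {n : ℕ} {P : Measure (Idx n → ℝ)}

theorem integrable_mul_of_memLp (hP : ∀ k, MemLp (fun X : Idx n → ℝ => X k) 2 P) (k l : Idx n) :
    Integrable (fun X : Idx n → ℝ => X k * X l) P := (hP k).integrable_mul (hP l)

theorem integrable_energyIn_signal (hg : MemLp g 2)
    (hP : ∀ k, MemLp (fun X : Idx n → ℝ => X k) 2 P) (Ω : Set ℝ) :
    Integrable (fun X => energyIn (signal g T n X) Ω) P := by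
  simp_rw [energyIn_signal hg]
  exact integrable_finsetSum _ fun k _ => integrable_finsetSum _ fun l _ =>
    (integrable_mul_of_memLp hP k l).mul_const _

/-- For uncorrelated data of equal power the mean energies of the effective pulses add up. -/
theorem integral_energyIn_signal (hg : MemLp g 2)
    (hP : ∀ k, MemLp (fun X : Idx n → ℝ => X k) 2 P) {v : ℝ}
    (hv : ∀ k l, ∫ X, X k * X l ∂P = if k = l then v else 0) (Ω : Set ℝ) :
    ∫ X, energyIn (signal g T n X) Ω ∂P =
      v * ∑ l : Idx n, energyIn (effectivePulse g T n l) Ω := by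
  simp_rw [energyIn_signal hg]
  have hi : ∀ k l : Idx n, Integrable (fun X : Idx n → ℝ => X k * X l *
      ∫ t in Ω, (effectivePulse g T n k t * conj (effectivePulse g T n l t)).re) P := fun k l =>
    (integrable_mul_of_memLp hP k l).mul_const _
  rw [integral_finsetSum _ fun k _ => integrable_finsetSum _ fun l _ => hi k l, Finset.mul_sum]
  refine Finset.sum_congr rfl fun k _ => ?_
  rw [integral_finsetSum _ fun l _ => hi k l, Finset.sum_eq_single k]
  · rw [integral_mul_const, hv, if_pos rfl]
    congr 1
    unfold energyIn
    congr 1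
    ext t
    rw [Complex.mul_conj']
    norm_cast
  · intro l _ hl
    rw [integral_mul_const, hv, if_neg (Ne.symm hl), zero_mul]
  · simp

namespace HasLimitPulse

theorem integral_energy_signal (h : HasLimitPulse g s T)
    (hP : ∀ k, MemLp (fun X : Idx n → ℝ => X k) 2 P) {v : ℝ}
    (hv : ∀ k l, ∫ X, X k * X l ∂P = if k = l then v else 0) :
    ∫ X, energy (signal g T n X) ∂P = v * (2 * n + 1) := by
  simp_rw [← energyIn_univ]
  rw [integral_energyIn_signal h.memLp hP hv]
  simp only [energyIn_univ, h.energy_effectivePulse]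
  rw [Finset.sum_const, Finset.card_univ, card_Idx, nsmul_eq_mul]
  push_cast
  ring

theorem eventually_mean_localized (h : HasLimitPulse g s T) {μ : ℝ} (hμ : 0 < μ) :
    ∀ᶠ n : ℕ in atTop, ∀ P : Measure (Idx n → ℝ), IsProbabilityMeasure P →
      (∀ k, MemLp (fun X : Idx n → ℝ => X k) 2 P) →
      ∀ v : ℝ, 0 < v → (∀ k l, ∫ X, X k * X l ∂P = if k = l then v else 0) →
      (1 - μ) * ∫ X, energy (signal g T n X) ∂P ≤
        ∫ X, energyIn (signal g T n X) (window T n) ∂P := by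
  filter_upwards [h.tendsto_average_energyIn_compl.eventually (gt_mem_nhds hμ)]
    with n hn P _ hP v hv hvP
  have h1 : ∫ X, energyIn (signal g T n X) (window T n) ∂P =
      ∫ X, energy (signal g T n X) ∂P - ∫ X, energyIn (signal g T n X) (window T n)ᶜ ∂P := by
    have hi := integrable_energyIn_signal (T := T) h.memLp hP Set.univ
    simp only [energyIn_univ] at hi
    rw [← integral_sub hi (integrable_energyIn_signal h.memLp hP _)]
    congr 1
    ext X
    rw [← energyIn_add_compl (memLp_signal h.memLp T n X) (measurableSet_window T n)]
    ring
  rw [h1, h.integral_energy_signal hP hvP, integral_energyIn_signal h.memLp hP hvP]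
  rw [div_lt_iff₀ (by positivity)] at hn
  nlinarith

end HasLimitPulse

section IID

theorem exists_integral_truncation_gt {ν : Measure ℝ} (hν : MemLp (fun x : ℝ => x) 2 ν)
    (hv : 0 < ∫ x, x ^ 2 ∂ν) :
    ∃ C : ℝ, 0 ≤ C ∧ 3 / 4 * ∫ x, x ^ 2 ∂ν < ∫ x, min (x ^ 2) C ∂ν := by
  have h1 : Tendsto (fun C : ℕ => ∫ x, min (x ^ 2) (C : ℝ) ∂ν) atTop (𝓝 (∫ x, x ^ 2 ∂ν)) := by
    refine tendsto_integral_of_dominated_convergence (fun x => x ^ 2) (fun C => ?_)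
      hν.integrable_sq (fun C => ae_of_all _ fun x => ?_) (ae_of_all _ fun x => ?_)
    · exact ((measurable_id.pow_const 2).min measurable_const).aestronglyMeasurable
    · rw [Real.norm_of_nonneg (by positivity)]
      exact min_le_left _ _
    · refine tendsto_const_nhds.congr' ?_
      obtain ⟨N, hN⟩ := exists_nat_ge (x ^ 2)
      filter_upwards [eventually_ge_atTop N] with C hC
      rw [min_eq_left (hN.trans (by exact_mod_cast hC))]
  obtain ⟨C, hC⟩ := (h1.eventually (lt_mem_nhds
    (show 3 / 4 * ∫ x, x ^ 2 ∂ν < ∫ x, x ^ 2 ∂ν by linarith))).exists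
  exact ⟨C, by positivity, hC⟩

variable {ν : Measure ℝ} [IsProbabilityMeasure ν]

theorem memLp_eval (hν : MemLp (fun x : ℝ => x) 2 ν) (k : Idx n) :
    MemLp (fun X : Idx n → ℝ => X k) 2 (Measure.pi fun _ : Idx n => ν) :=
  hν.comp_measurePreserving (measurePreserving_eval (fun _ : Idx n => ν) k)

theorem integral_mul_eval (h0 : ∫ x, x ∂ν = 0) (k l : Idx n) :
    ∫ X, X k * X l ∂(Measure.pi fun _ : Idx n => ν) = if k = l then ∫ x, x ^ 2 ∂ν else 0 := by
  split_ifs with hkl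
  · subst hkl
    have := integral_comp_eval (μ := fun _ : Idx n => ν) (i := k) (f := fun x : ℝ => x ^ 2)
      (by fun_prop)
    simpa only [pow_two] using this
  · have hind := ProbabilityTheory.iIndepFun_pi (μ := fun _ : Idx n => ν)
      (X := fun _ => (id : ℝ → ℝ)) fun _ => aemeasurable_id
    have h1 := (hind.indepFun hkl).integral_mul_eq_mul_integral
      (measurable_pi_apply k).aestronglyMeasurable (measurable_pi_apply l).aestronglyMeasurable
    have h2 := integral_comp_eval (μ := fun _ : Idx n => ν) (i := k) (f := fun x : ℝ => x)
      (by fun_prop)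
    simp only [Pi.mul_apply, id_eq] at h1
    rw [h1, h2, h0, zero_mul]

/-- Chebyshev's inequality for sums of pairwise independent random variables with values in an
interval `[0, C]`. -/
theorem measure_abs_sum_sub_integral_ge_le {Ω ι : Type*} [Fintype ι] [MeasurableSpace Ω]
    {P : Measure Ω} [IsProbabilityMeasure P] {Y : ι → Ω → ℝ} (hY : ∀ k, Measurable (Y k)) {C : ℝ}
    (hYC : ∀ k ω, Y k ω ∈ Set.Icc 0 C)
    (hind : ∀ k l, k ≠ l → ProbabilityTheory.IndepFun (Y k) (Y l) P) {a : ℝ} (ha : 0 < a) :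
    P {ω | a ≤ |∑ k, Y k ω - ∑ k, ∫ ω', Y k ω' ∂P|} ≤
      ENNReal.ofReal (Fintype.card ι * C ^ 2 / a ^ 2) := by
  have hL : ∀ k, MemLp (Y k) 2 P := fun k =>
    MemLp.of_bound (hY k).aestronglyMeasurable C (ae_of_all _ fun ω => by
      rw [Real.norm_of_nonneg (hYC k ω).1]
      exact (hYC k ω).2)
  have hint : ∫ ω, (∑ k, Y k) ω ∂P = ∑ k, ∫ ω, Y k ω ∂P := by
    simp only [Finset.sum_apply]
    exact integral_finsetSum _ fun k _ => (hL k).integrable (by norm_num)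
  have hvar1 : ∀ k, ProbabilityTheory.variance (Y k) P ≤ C ^ 2 := fun k =>
    (ProbabilityTheory.variance_le_sq_of_bounded (ae_of_all _ fun ω => hYC k ω)
      (hY k).aemeasurable).trans (by nlinarith [sq_nonneg C])
  have hvar : ProbabilityTheory.variance (∑ k, Y k) P ≤ Fintype.card ι * C ^ 2 := by
    rw [ProbabilityTheory.IndepFun.variance_sum (fun k _ => hL k)
      fun k _ l _ hkl => hind k l hkl]
    refine (Finset.sum_le_sum fun k _ => hvar1 k).trans_eq ?_
    rw [Finset.sum_const, Finset.card_univ, nsmul_eq_mul]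
  have h1 := ProbabilityTheory.meas_ge_le_variance_div_sq
    (memLp_finsetSum' Finset.univ fun k _ => hL k) ha
  rw [hint] at h1
  simp only [Finset.sum_apply] at h1
  exact h1.trans (ENNReal.ofReal_le_ofReal (by gcongr))

/-- The weak law of large numbers for bounded functions of the symbols of a random data vector,
with an explicit bound. -/
theorem measure_abs_sum_sub_ge_le {φ : ℝ → ℝ} (hφ : Measurable φ) {C : ℝ}
    (hφC : ∀ x, φ x ∈ Set.Icc 0 C) {c : ℝ} (hc : 0 < c) (n : ℕ) :
    (Measure.pi fun _ : Idx n => ν)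
      {X | (2 * n + 1) * c ≤ |∑ k, φ (X k) - (2 * n + 1) * ∫ x, φ x ∂ν|} ≤
      ENNReal.ofReal (C ^ 2 / c ^ 2 / (2 * n + 1)) := by
  have hind := ProbabilityTheory.iIndepFun_pi (μ := fun _ : Idx n => ν)
    (X := fun _ => φ) fun _ => hφ.aemeasurable
  have h1 := measure_abs_sum_sub_integral_ge_le (P := Measure.pi fun _ : Idx n => ν)
    (Y := fun k X => φ (X k)) (fun k => hφ.comp (measurable_pi_apply k))
    (fun k X => hφC (X k)) (fun k l hkl => hind.indepFun hkl)
    (show 0 < (2 * (n : ℝ) + 1) * c by positivity)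
  have h2 : ∑ k : Idx n, ∫ X : Idx n → ℝ, φ (X k) ∂(Measure.pi fun _ : Idx n => ν) =
      (2 * n + 1) * ∫ x, φ x ∂ν := by
    rw [Finset.sum_congr rfl fun k _ => integral_comp_eval (μ := fun _ : Idx n => ν) (i := k)
      hφ.aestronglyMeasurable, Finset.sum_const, Finset.card_univ, card_Idx, nsmul_eq_mul]
    push_cast
    ring
  rw [h2, card_Idx] at h1
  refine h1.trans_eq (congrArg _ ?_)
  push_cast
  field_simp

/-- For independent identically distributed data, Markov's inequality bounds the energy outside the
window by a small multiple of `2n+1`, while by the law of large numbers (applied to the truncated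
squares, which have a finite variance) the total energy is at least half of its mean. -/
theorem HasLimitPulse.tendsto_measure_concentration (h : HasLimitPulse g s T)
    (hν : MemLp (fun x : ℝ => x) 2 ν) (h0 : ∫ x, x ∂ν = 0) (hv : 0 < ∫ x, x ^ 2 ∂ν)
    {μ : ℝ} (hμ : 0 < μ) :
    Tendsto (fun n : ℕ => Measure.pi (fun _ : Idx n => ν)
      {X | 1 - μ ≤ concentration (signal g T n X) (window T n)}) atTop (𝓝 1) := by
  set v := ∫ x, x ^ 2 ∂ν with hvdef
  obtain ⟨C, hC0, hC⟩ := exists_integral_truncation_gt hν hv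
  set y := ∫ x, min (x ^ 2) C ∂ν with hy
  set A : ∀ n : ℕ, Set (Idx n → ℝ) := fun n =>
    {X | μ * ((2 * n + 1) * (v / 2)) ≤ energyIn (signal g T n X) (window T n)ᶜ} with hA
  set B : ∀ n : ℕ, Set (Idx n → ℝ) := fun n =>
    {X | (2 * n + 1) * (v / 4) ≤ |∑ k, min (X k ^ 2) C - (2 * n + 1) * y|} with hB
  have hPA : Tendsto (fun n => Measure.pi (fun _ : Idx n => ν) (A n)) atTop (𝓝 0) := by
    have h1 : Tendsto (fun n : ℕ => ENNReal.ofReal (2 / μ *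
        ((∑ l : Idx n, energyIn (effectivePulse g T n l) (window T n)ᶜ) / (2 * n + 1))))
        atTop (𝓝 0) := by
      have := ENNReal.tendsto_ofReal (h.tendsto_average_energyIn_compl.const_mul (2 / μ))
      simpa using this
    refine tendsto_of_tendsto_of_tendsto_of_le_of_le tendsto_const_nhds h1 (fun _ => zero_le) ?_
    intro n
    have h2 := mul_meas_ge_le_integral_of_nonneg
      (ae_of_all (Measure.pi fun _ : Idx n => ν) fun X =>
        energyIn_nonneg (signal g T n X) (window T n)ᶜ)
      (integrable_energyIn_signal h.memLp (fun k => memLp_eval hν k) _)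
      (μ * ((2 * n + 1) * (v / 2)))
    rw [integral_energyIn_signal h.memLp (fun k => memLp_eval hν k) (integral_mul_eval h0)] at h2
    refine (ENNReal.le_ofReal_iff_toReal_le (measure_ne_top _ _) ?_).2 ?_
    · have := Finset.sum_nonneg fun (l : Idx n) (_ : l ∈ Finset.univ) =>
        energyIn_nonneg (effectivePulse g T n l) (window T n)ᶜ
      positivity
    · have hN : (0 : ℝ) < 2 * n + 1 := by positivity
      have h3 : (Measure.pi fun _ : Idx n => ν).real (A n) ≤
          (v * ∑ l : Idx n, energyIn (effectivePulse g T n l) (window T n)ᶜ) /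
            (μ * ((2 * n + 1) * (v / 2))) := by
        rw [le_div_iff₀ (by positivity), mul_comm]
        exact h2
      refine h3.trans_eq ?_
      field_simp
  have hPB : Tendsto (fun n => Measure.pi (fun _ : Idx n => ν) (B n)) atTop (𝓝 0) := by
    have h1 : Tendsto (fun n : ℕ => ENNReal.ofReal (C ^ 2 / (v / 4) ^ 2 / (2 * n + 1)))
        atTop (𝓝 0) := by
      have h2 : Tendsto (fun n : ℕ => 2 * (n : ℝ) + 1) atTop atTop :=
        tendsto_atTop_add_const_right _ _
          (tendsto_natCast_atTop_atTop.const_mul_atTop (by norm_num))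
      have := ENNReal.tendsto_ofReal (h2.const_div_atTop (C ^ 2 / (v / 4) ^ 2))
      simpa using this
    refine tendsto_of_tendsto_of_tendsto_of_le_of_le tendsto_const_nhds h1 (fun _ => zero_le) ?_
    intro n
    exact measure_abs_sum_sub_ge_le (φ := fun x => min (x ^ 2) C)
      ((measurable_id.pow_const 2).min measurable_const)
      (fun x => ⟨le_min (sq_nonneg x) hC0, min_le_right _ _⟩) (by positivity) n
  have hlow : Tendsto (fun n => 1 - (Measure.pi (fun _ : Idx n => ν) (A n) +
      Measure.pi (fun _ : Idx n => ν) (B n))) atTop (𝓝 1) := by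
    have := ENNReal.Tendsto.sub (tendsto_const_nhds (x := (1 : ℝ≥0∞))) (hPA.add hPB)
      (Or.inl ENNReal.one_ne_top)
    simpa using this
  refine tendsto_of_tendsto_of_tendsto_of_le_of_le hlow tendsto_const_nhds (fun n => ?_)
    fun n => prob_le_one
  set G := {X | 1 - μ ≤ concentration (signal g T n X) (window T n)} with hG
  have hcover : Set.univ ⊆ G ∪ (A n ∪ B n) := by
    intro X _
    by_contra hX
    simp only [Set.mem_union, not_or] at hX
    obtain ⟨hXG, hXA, hXB⟩ := hX
    have hXA' : energyIn (signal g T n X) (window T n)ᶜ < μ * ((2 * n + 1) * (v / 2)) :=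
      not_le.1 hXA
    have hXB' : |∑ k, min (X k ^ 2) C - (2 * n + 1) * y| < (2 * n + 1) * (v / 4) := not_le.1 hXB
    have hN : (0 : ℝ) < 2 * n + 1 := by positivity
    have h1 : ∑ k, min (X k ^ 2) C ≤ ∑ k, X k ^ 2 :=
      Finset.sum_le_sum fun k _ => min_le_left _ _
    have h2 := (abs_lt.1 hXB').1
    have h3 : (2 * n + 1) * (v / 2) < ∑ k, X k ^ 2 := by nlinarith
    have h4 : 0 < ∑ k, X k ^ 2 := lt_trans (by positivity) h3
    refine hXG ?_
    change 1 - μ ≤ _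
    rw [h.concentration_signal n X (measurableSet_window T n) h4.ne']
    have h5 : energyIn (signal g T n X) (window T n)ᶜ / ∑ k, X k ^ 2 ≤ μ := by
      rw [div_le_iff₀ h4]
      exact hXA'.le.trans (by gcongr)
    linarith
  rw [tsub_le_iff_right]
  calc (1 : ℝ≥0∞) = Measure.pi (fun _ : Idx n => ν) Set.univ := measure_univ.symm
    _ ≤ Measure.pi (fun _ : Idx n => ν) (G ∪ (A n ∪ B n)) := measure_mono hcover
    _ ≤ _ := (measure_union_le _ _).trans (by gcongr; exact measure_union_le _ _)

end IID

end Random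

/-! ### Uniform localization for pulses with decay `1/|t|` -/

section Uniform

theorem integral_compl_Icc_sq {R : ℝ} (hR : 0 < R) :
    IntegrableOn (fun t : ℝ => 1 / t ^ 2) (Set.Icc (-R) R)ᶜ ∧
      ∫ t in (Set.Icc (-R) R)ᶜ, 1 / t ^ 2 = 2 / R := by
  have e : ∀ t ∈ Set.Ioi R, t ^ (-2 : ℝ) = 1 / t ^ 2 := fun t ht => by
    rw [Real.rpow_neg (hR.trans ht).le, one_div]
    norm_cast
  have h1 : IntegrableOn (fun t : ℝ => 1 / t ^ 2) (Set.Ioi R) :=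
    (integrableOn_Ioi_rpow_of_lt (by norm_num : (-2 : ℝ) < -1) hR).congr_fun e measurableSet_Ioi
  have h2 : ∫ t in Set.Ioi R, 1 / t ^ 2 = 1 / R := by
    rw [← setIntegral_congr_fun measurableSet_Ioi e,
      integral_Ioi_rpow_of_lt (by norm_num : (-2 : ℝ) < -1) hR]
    norm_num
    rw [Real.rpow_neg_one]
  have h3 : IntegrableOn (fun t : ℝ => 1 / t ^ 2) (Set.Iio (-R)) := by
    have := IntegrableOn.comp_neg_Iio (c := -R) (f := fun t : ℝ => 1 / t ^ 2) (μ := volume)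
      (by rwa [neg_neg])
    simpa using this
  have h4 : ∫ t in Set.Iio (-R), 1 / t ^ 2 = 1 / R := by
    rw [← integral_Iic_eq_integral_Iio, ← integral_comp_neg_Ioi R (fun t : ℝ => 1 / t ^ 2), ← h2]
    simp
  have hset : (Set.Icc (-R) R)ᶜ = Set.Iio (-R) ∪ Set.Ioi R := by
    ext t
    simp only [Set.mem_compl_iff, Set.mem_Icc, Set.mem_union, Set.mem_Iio, Set.mem_Ioi,
      not_and_or, not_le]
  have hdis : Disjoint (Set.Iio (-R)) (Set.Ioi R) := by
    rw [Set.disjoint_left]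
    intro t h5 h6
    have h5' : t < -R := h5
    have h6' : R < t := h6
    linarith
  rw [hset]
  refine ⟨h3.union h1, ?_⟩
  rw [setIntegral_union hdis measurableSet_Ioi h3 h1, h2, h4]
  ring

/-- Localization of all signals of a pulse with decay `1/|t|` whose precoded symbols are bounded
by the data: by the Cauchy–Schwarz inequality the signal is `O(√n / |t|)` beyond twice the length
of the block. -/
theorem exists_concentration_ge {g : ℝ → ℂ} {T D c : ℝ} (hT : 0 < T) (hg : MemLp g 2) (hD : 0 ≤ D)
    (hc : 0 ≤ c) (hdecay : ∀ᵐ t, 1 ≤ |t| → ‖g t‖ ≤ D / |t|)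
    (hen : ∀ n (X : Idx n → ℝ), energy (signal g T n X) = ∑ l, X l ^ 2)
    (hpre : ∀ n (X : Idx n → ℝ), ∑ k, ‖precode g T n X k‖ ^ 2 ≤ c * ∑ l, X l ^ 2)
    {μ : ℝ} (hμ : 0 < μ) :
    ∃ K : ℝ, 0 < K ∧ ∀ n : ℕ, 1 ≤ n → ∀ X : Idx n → ℝ, X ≠ 0 →
      1 - μ ≤ concentration (signal g T n X) (Set.Icc (-(K * n * T)) (K * n * T)) := by
  set K := 2 + 2 / T + 24 * c * D ^ 2 / (μ * T) with hK
  have hK2 : 2 ≤ K := by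
    have h1 : 0 ≤ 2 / T := by positivity
    have h2 : 0 ≤ 24 * c * D ^ 2 / (μ * T) := by positivity
    linarith
  have hKT : 2 ≤ K * T := by
    have h2 : 0 ≤ 24 * c * D ^ 2 / (μ * T) := by positivity
    have h3 : 2 / T ≤ K := by linarith
    rwa [div_le_iff₀ hT] at h3
  have hKμ : 24 * c * D ^ 2 ≤ μ * (K * T) := by
    have h1 : 0 ≤ 2 / T := by positivity
    have h3 : 24 * c * D ^ 2 / (μ * T) ≤ K := by linarith
    rw [div_le_iff₀ (by positivity)] at h3
    linarith
  refine ⟨K, by linarith, fun n hn X hX => ?_⟩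
  have hn' : (1 : ℝ) ≤ n := by exact_mod_cast hn
  set R := K * n * T with hR
  have hR0 : 0 < R := by positivity
  have hX0 : 0 < ∑ l, X l ^ 2 := by
    obtain ⟨k, hk⟩ := Function.ne_iff.1 hX
    have hk' : X k ≠ 0 := hk
    exact Finset.sum_pos' (fun l _ => sq_nonneg _) ⟨k, Finset.mem_univ _, by positivity⟩
  rw [concentration_eq (memLp_signal hg T n X) measurableSet_Icc (by rw [hen]; exact hX0.ne'), hen]
  suffices h : energyIn (signal g T n X) (Set.Icc (-R) R)ᶜ ≤ μ * ∑ l, X l ^ 2 by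
    rw [← div_le_iff₀ hX0] at h
    linarith
  obtain ⟨hint, hval⟩ := integral_compl_Icc_sq hR0
  have hshift : ∀ᵐ t, ∀ k : Idx n, 1 ≤ |t - k * T| → ‖shifted g T k t‖ ≤ D / |t - k * T| :=
    ae_all_iff.2 fun k =>
      (measurePreserving_sub_const (k * T)).quasiMeasurePreserving.ae hdecay
  have hbound : ∀ᵐ t ∂(volume.restrict (Set.Icc (-R) R)ᶜ), ‖signal g T n X t‖ ^ 2 ≤
      (c * ∑ l, X l ^ 2) * ((2 * n + 1) * (4 * D ^ 2)) * (1 / t ^ 2) := by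
    rw [ae_restrict_iff' measurableSet_Icc.compl]
    filter_upwards [hshift] with t ht htR
    have htR' : R < |t| := by
      by_contra h1
      exact htR (abs_le.1 (not_lt.1 h1))
    have ht0 : 0 < |t| := hR0.trans htR'
    have hk : ∀ k : Idx n, ‖shifted g T k t‖ ^ 2 ≤ 4 * D ^ 2 * (1 / t ^ 2) := by
      intro k
      have h1 : |(k : ℤ)| ≤ n := abs_le.2 (Finset.mem_Icc.1 k.2)
      have h2 : (|((k : ℤ) : ℝ)|) ≤ n := by exact_mod_cast h1
      have h3 : |t| - |((k : ℤ) : ℝ) * T| ≤ |t - (k : ℤ) * T| := abs_sub_abs_le_abs_sub _ _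
      rw [abs_mul, abs_of_pos hT] at h3
      have h4 : |((k : ℤ) : ℝ)| * T ≤ n * T := by gcongr
      have h5 : 2 * (n * T) ≤ R := by
        rw [hR, mul_assoc]; gcongr
      have h6 : |t| / 2 ≤ |t - (k : ℤ) * T| := by linarith
      have h7 : 2 ≤ R := by
        have : K * T * 1 ≤ K * T * n := by gcongr
        rw [hR]; linarith
      have h8 := (ht k (by linarith)).trans
        (div_le_div_of_nonneg_left hD (by positivity) h6)
      calc ‖shifted g T k t‖ ^ 2 ≤ (D / (|t| / 2)) ^ 2 :=
            pow_le_pow_left₀ (norm_nonneg _) h8 2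
        _ = 4 * D ^ 2 * (1 / t ^ 2) := by
            rw [div_pow, div_pow, sq_abs]
            field_simp
            ring
    have hcs := Finset.sum_mul_sq_le_sq_mul_sq Finset.univ
      (fun k : Idx n => ‖precode g T n X k‖) fun k => ‖shifted g T k t‖
    have h9 : ‖signal g T n X t‖ ^ 2 ≤
        (∑ k : Idx n, ‖precode g T n X k‖ * ‖shifted g T k t‖) ^ 2 := by
      refine pow_le_pow_left₀ (norm_nonneg _) ((norm_sum_le _ _).trans_eq ?_) 2
      exact Finset.sum_congr rfl fun k _ => norm_mul _ _
    refine (h9.trans hcs).trans ?_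
    rw [mul_assoc]
    refine mul_le_mul (hpre n X) ?_ (Finset.sum_nonneg fun k _ => sq_nonneg _) (by positivity)
    calc _ ≤ ∑ _k : Idx n, 4 * D ^ 2 * (1 / t ^ 2) := Finset.sum_le_sum fun k _ => hk k
      _ = _ := by
        rw [Finset.sum_const, Finset.card_univ, card_Idx, nsmul_eq_mul]
        push_cast
        ring
  calc energyIn (signal g T n X) (Set.Icc (-R) R)ᶜ
      ≤ ∫ t in (Set.Icc (-R) R)ᶜ,
          (c * ∑ l, X l ^ 2) * ((2 * n + 1) * (4 * D ^ 2)) * (1 / t ^ 2) :=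
        integral_mono_ae (integrable_norm_sq (memLp_signal hg T n X)).integrableOn
          (hint.const_mul _) hbound
    _ = (∑ l, X l ^ 2) * (c * ((2 * n + 1) * (4 * D ^ 2)) * (2 / R)) := by
        rw [integral_const_mul, hval]; ring
    _ ≤ (∑ l, X l ^ 2) * μ := by
        gcongr
        rw [mul_div_assoc', div_le_iff₀ hR0, hR]
        have h1 : (2 * n + 1 : ℝ) ≤ 3 * n := by linarith
        calc c * ((2 * n + 1) * (4 * D ^ 2)) * 2 ≤ c * (3 * n * (4 * D ^ 2)) * 2 := by gcongr
          _ = 24 * c * D ^ 2 * n := by ring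
          _ ≤ μ * (K * T) * n := by gcongr
          _ = μ * (K * n * T) := by ring
    _ = _ := mul_comm _ _

end Uniform

end PrecodedFTN

theorem theorem1 (W' T' : ℝ) (hW' : 0 < W') (hT' : T' = 1 / (2 * W')) (g G : ℝ → ℂ)
    (hgG : PrecodedFTN.IsL2FourierTransform g G)
    (hC1 : PrecodedFTN.PiecewiseC1 fun ω => ‖G ω‖)
    (hne : ∀ ω : ℝ, |ω| ≤ 2 * Real.pi * W' → G ω ≠ 0)
    (hzero : ∀ ω : ℝ, 2 * Real.pi * W' < |ω| → G ω = 0)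
    (heven : ∀ᵐ ω : ℝ, ‖G (-ω)‖ = ‖G ω‖) :
    -- the Gram matrices are positive definite
    (∀ n : ℕ, (PrecodedFTN.gram g T' n).PosDef) ∧
    -- each symbol is carried by its effective pulse, and precoding preserves the energy
    (∀ (n : ℕ) (X : PrecodedFTN.Idx n → ℝ),
      (∀ t : ℝ, PrecodedFTN.signal g T' n X t =
        ∑ l : PrecodedFTN.Idx n, (X l : ℂ) * PrecodedFTN.effectivePulse g T' n l t) ∧
      PrecodedFTN.energy (PrecodedFTN.signal g T' n X) = ∑ l : PrecodedFTN.Idx n, X l ^ 2) ∧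
    -- the effective pulses tend to the shifts by `lT'` of one pulse `s` whose amplitude spectrum
    -- is that of a sinc pulse, and which is the sinc pulse when `G > 0` on the band
    (∃ s : ℝ → ℂ,
      PrecodedFTN.IsL2FourierTransform s (fun ω => (Real.sqrt T' : ℂ) * (G ω / (‖G ω‖ : ℂ))) ∧
      ((∀ ω : ℝ, |ω| ≤ 2 * Real.pi * W' → G ω = (‖G ω‖ : ℂ)) →
        s =ᵐ[volume] fun t => ((1 / Real.sqrt T' * Real.sinc (Real.pi * t / T') : ℝ) : ℂ)) ∧
      (∀ l : ℤ, Tendsto (fun n : ℕ => PrecodedFTN.energy fun t =>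
          PrecodedFTN.effectivePulse g T' n l t - PrecodedFTN.shifted s T' l t)
        atTop (𝓝 0)) ∧
      Tendsto (fun n : ℕ => (∑ l : PrecodedFTN.Idx n, PrecodedFTN.energy fun t =>
          PrecodedFTN.effectivePulse g T' n l t - PrecodedFTN.shifted s T' l t) / (2 * n + 1))
        atTop (𝓝 0)) ∧
    -- localization to `[-nT', nT']`, for a fixed data sequence of finite energy
    (∀ x : ℤ → ℝ, Summable (fun k => x k ^ 2) → x ≠ 0 →
      Tendsto (fun n : ℕ => PrecodedFTN.concentration
          (PrecodedFTN.signal g T' n fun k => x k) (PrecodedFTN.window T' n))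
        atTop (𝓝 1)) ∧
    -- localization to `[-nT', nT']`, in the mean, for random data vectors with uncorrelated entries
    -- of equal power, uniformly in their law
    (∀ μ : ℝ, 0 < μ → ∀ᶠ n : ℕ in atTop,
      ∀ P : Measure (PrecodedFTN.Idx n → ℝ), IsProbabilityMeasure P →
        (∀ k, MemLp (fun X : PrecodedFTN.Idx n → ℝ => X k) 2 P) →
        ∀ v : ℝ, 0 < v →
        (∀ k l, ∫ X, X k * X l ∂P = if k = l then v else 0) →
        (1 - μ) * ∫ X, PrecodedFTN.energy (PrecodedFTN.signal g T' n X) ∂P ≤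
          ∫ X, PrecodedFTN.energyIn (PrecodedFTN.signal g T' n X)
            (PrecodedFTN.window T' n) ∂P) ∧
    -- localization to `[-nT', nT']`, with probability tending to one, for independent identically
    -- distributed data symbols
    (∀ ν : Measure ℝ, IsProbabilityMeasure ν → MemLp (fun x : ℝ => x) 2 ν →
      ∫ x, x ∂ν = 0 → 0 < ∫ x, x ^ 2 ∂ν → ∀ μ : ℝ, 0 < μ →
      Tendsto (fun n : ℕ => Measure.pi (fun _ : PrecodedFTN.Idx n => ν)
          {X | 1 - μ ≤ PrecodedFTN.concentration (PrecodedFTN.signal g T' n X)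
            (PrecodedFTN.window T' n)})
        atTop (𝓝 1)) ∧
    -- localization of every signal to a proportional interval, uniformly in `n` and in the data,
    -- when `G` itself is piecewise continuously differentiable and bounded away from zero
    (PrecodedFTN.PiecewiseC1 G →
      (∃ c : ℝ, 0 < c ∧ ∀ ω : ℝ, |ω| ≤ 2 * Real.pi * W' → c ≤ ‖G ω‖) →
      ∀ μ : ℝ, 0 < μ → ∃ K : ℝ, 0 < K ∧ ∀ n : ℕ, 1 ≤ n →
        ∀ X : PrecodedFTN.Idx n → ℝ, X ≠ 0 →
          1 - μ ≤ PrecodedFTN.concentration (PrecodedFTN.signal g T' n X)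
            (Set.Icc (-(K * n * T')) (K * n * T'))) := by
  set Γ : ℝ → ℂ := fun ξ => G (2 * Real.pi * ξ) with hΓdef
  have hpi : 0 < 2 * Real.pi := by positivity
  obtain ⟨hg, hΓ⟩ := PrecodedFTN.isL2FourierTransform_iff.1 hgG
  have habs : ∀ ξ : ℝ, |2 * Real.pi * ξ| = 2 * Real.pi * |ξ| := fun ξ => by
    rw [abs_mul, abs_of_pos hpi]
  have hT0 : 0 < T' := by rw [hT']; positivity
  obtain ⟨C, hC⟩ := hC1.exists_bound (B := 2 * Real.pi * W') fun ω hω => by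
    rw [hzero ω hω, norm_zero]
  have h : PrecodedFTN.IsBandSpectrum Γ W' :=
    { pos := hW'
      aestronglyMeasurable := (Lp.aestronglyMeasurable _).congr hΓ.symm
      bounded := ⟨C, fun ξ => by simpa using hC (2 * Real.pi * ξ)⟩
      ne_zero := fun ξ hξ => hne _ (by rw [habs]; gcongr)
      eq_zero := fun ξ hξ => hzero _ (by rw [habs]; gcongr) }
  have heven' : ∀ᵐ ξ : ℝ, ‖Γ (-ξ)‖ = ‖Γ ξ‖ := by
    filter_upwards [(PrecodedFTN.quasiMeasurePreserving_const_mul hpi.ne').ae heven] with ξ hξ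
    simpa only [hΓdef, mul_neg] using hξ
  have hlim : PrecodedFTN.HasLimitPulse g (PrecodedFTN.limitPulse h T') T' :=
    { pos := hT0
      memLp := hg
      memLp_limit := PrecodedFTN.memLp_limitPulse h T'
      energy_signal := PrecodedFTN.energy_signal h hT' hg hΓ heven'
      exists_energy_sub_le := fun ε hε =>
        PrecodedFTN.exists_energy_effectivePulse_sub_le h hT' hg hΓ heven' hε }
  refine ⟨PrecodedFTN.gram_posDef h hT' hg hΓ heven', fun n X =>
    ⟨PrecodedFTN.signal_eq_sum_effectivePulse g T' n X, hlim.energy_signal n X⟩,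
    ⟨PrecodedFTN.limitPulse h T', ?_, fun hpos => ?_, hlim.tendsto_energy_sub,
      hlim.tendsto_average_energy_sub⟩, fun x hx hx0 => hlim.tendsto_concentration hx hx0,
    fun μ hμ => hlim.eventually_mean_localized hμ,
    fun ν _ hν h0 hv μ hμ => hlim.tendsto_measure_concentration hν h0 hv hμ,
    fun hG ⟨c, hc0, hc⟩ μ hμ => ?_⟩
  · refine PrecodedFTN.isL2FourierTransform_iff.2 ⟨PrecodedFTN.memLp_limitPulse h T', ?_⟩
    rw [PrecodedFTN.fourier_toLp_limitPulse]
    exact (h.memLp_flatSpectrum T' 2).coeFn_toLp.symm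
  · exact PrecodedFTN.limitPulse_ae_eq_sinc h hT' fun ξ hξ => hpos _ (by rw [habs]; gcongr)
  · obtain ⟨D, hD, hdecay⟩ := PrecodedFTN.exists_norm_pulse_le hG h hg hΓ
    exact PrecodedFTN.exists_concentration_ge hT0 hg hD (c := T' / c ^ 2) (by positivity) hdecay
      hlim.energy_signal (PrecodedFTN.sum_norm_sq_precode_le h hT' hg hΓ heven' hc0
        fun ξ hξ => hc _ (by rw [habs]; gcongr)) hμ
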